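/- There is an absolute constant $C>0$ such that the following holds. Let $d\ge 1$ and $n_1\le n_2$ be positive integers, let $\alpha,\beta\in(0,1)$ with $\alpha+\beta<1/2$, and let $\sigma>0$. Let $Z_1,\dots,Z_{n_1},W_1,\dots,W_{n_2}$ be mutually independent random vectors in $\mathbb{R}^d$, where $Z_1,\dots,Z_{n_1}$ have a common mean and $W_1,\dots,W_{n_2}$ have a common mean (for instance, where each sample is identically distributed). Suppose each of these vectors is $\mathrm{SG}(\sigma^2)$, where a random vector $X$ is called $\mathrm{SG}(\sigma^2)$ if $$\mathbb{E}\big[\exp\{\theta v^T(X-\mathbb{E}[X])\}\big]\le \exp\big(\theta^2\|v\|_2^2\sigma^2/2\big)\quad\text{for all } v\in\mathbb{R}^d,\ \theta\in\mathbb{R}.$$ Define the two-sample $U$-statistic $$U_{n_1,n_2}=\frac{1}{n_1(n_1-1)}\,\frac{1}{n_2(n_2-1)}\sum_{\substack{i,j\in[n_1]\\ i\ne j}}\ \sum_{\substack{k,l\in[n_2]\\ k\neq l}}(Z_i-W_k)^T(Z_j-W_l).$$ Write $D_i=Z_i$ for $i\in[n_1]$ and $D_{n_1+k}=W_k$ for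 $k\in[n_2]$, and for a permutation $\pi$ of $[n_1+n_2]$ let $$U^{\pi}_{n_1,n_2}=\frac{1}{n_1(n_1-1)}\,\frac{1}{n_2(n_2-1)}\sum_{\substack{i,j\in[n_1]\\ i\ne j}}\ \sum_{\substack{k,l\in[n_2]\\ k\neq l}}(D_{\pi(i)}-D_{\pi(n_1+k)})^T(D_{\pi(j)}-D_{\pi(n_1+l)}).$$ Let $\pi_1,\dots,\pi_B$ be independent, uniformly distributed random permutations of $[n_1+n_2]$, independent of the data, and let $$p_B=\frac{1+\sum_{b=1}^B \mathbf{1}\{U_{n_1,n_2}\le U_{n_1,n_2}^{\pi_b}\}}{1+B}.$$ If $B\ge 4/(\alpha\beta)-1$, $$\mathbb{E}[U_{n_1,n_2}]\ge \frac{C d^{1/2}\sigma^2}{n_1}\big[\log\{1/(\alpha\beta)\}\big]^2\quad\text{and}\quad n_1\ge C\log\{1/(\alpha\beta)\},$$ then $\mathbb{P}(p_B\ge\alpha)\le\beta$. (No relation between the sample sizes other than $n_1\le n_2$ is required; in particular $n_1\asymp n_2$ is not assumed.) -/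

import Mathlib

open MeasureTheory ProbabilityTheory
open scoped NNReal

/-- The symmetric group on a finite set of symbols carries the discrete σ-algebra. -/
instance permFinMeasurableSpace (n : ℕ) : MeasurableSpace (Equiv.Perm (Fin n)) := ⊤

noncomputable section

/-- The random vector `X` in `ℝ^d` is sub-Gaussian with variance proxy `s` (the `σ²` of `SG(σ²)`):
for every `v ∈ ℝ^d` and `θ ∈ ℝ` the variable `exp (θ vᵀ(X - E[X]))` is integrable and
`E[exp (θ vᵀ(X - E[X]))] ≤ exp (θ² ‖v‖₂² s / 2)`. -/
def IsSubGaussianVector {Ω : Type*} [MeasurableSpace Ω] {d : ℕ}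
    (X : Ω → EuclideanSpace ℝ (Fin d)) (s : ℝ≥0) (P : Measure Ω) : Prop :=
  ∀ v : EuclideanSpace ℝ (Fin d),
    HasSubgaussianMGF (fun ω => inner ℝ v (X ω - ∫ ω', X ω' ∂P)) (‖v‖₊ ^ 2 * s) P

/-- The two-sample `U`-statistic
`1/(n₁(n₁-1)) · 1/(n₂(n₂-1)) · ∑_{i≠j} ∑_{k≠l} (Z_i - W_k)ᵀ(Z_j - W_l)`. -/
def uStat {d n₁ n₂ : ℕ} (Z : Fin n₁ → EuclideanSpace ℝ (Fin d))
    (W : Fin n₂ → EuclideanSpace ℝ (Fin d)) : ℝ :=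
  1 / ((n₁ : ℝ) * ((n₁ : ℝ) - 1)) * (1 / ((n₂ : ℝ) * ((n₂ : ℝ) - 1))) *
    ∑ p ∈ (Finset.univ : Finset (Fin n₁)).offDiag,
      ∑ q ∈ (Finset.univ : Finset (Fin n₂)).offDiag,
        inner ℝ (Z p.1 - W q.1) (Z p.2 - W q.2)

/-- The `U`-statistic of the permuted pooled sample `D_{ρ(1)}, …, D_{ρ(n₁+n₂)}`, whose first `n₁`
entries play the role of the first sample and whose last `n₂` entries that of the second. -/
def permutedUStat {d n₁ n₂ : ℕ} (D : Fin (n₁ + n₂) → EuclideanSpace ℝ (Fin d))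
    (ρ : Equiv.Perm (Fin (n₁ + n₂))) : ℝ :=
  uStat (fun i : Fin n₁ => D (ρ (Fin.castAdd n₂ i))) (fun k : Fin n₂ => D (ρ (Fin.natAdd n₁ k)))

/-- The Monte Carlo permutation `p`-value `(1 + ∑_b 1{T ≤ T_b}) / (1 + B)` of a statistic with
value `T` on the data and values `T_1, …, T_B` on the permuted data. -/
def permPValue {B : ℕ} (T : ℝ) (Tperm : Fin B → ℝ) : ℝ :=
  (1 + ∑ b : Fin B, if T ≤ Tperm b then (1 : ℝ) else 0) / (1 + (B : ℝ))

/-- The permutation `p`-value of the two-sample `U`-statistic for the samples `Z`, `W` and the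
permutations `π_1, …, π_B` of the pooled sample `(Z_1, …, Z_{n₁}, W_1, …, W_{n₂})`. -/
def uStatPValue {d n₁ n₂ B : ℕ} (Z : Fin n₁ → EuclideanSpace ℝ (Fin d))
    (W : Fin n₂ → EuclideanSpace ℝ (Fin d))
    (π : Fin B → Equiv.Perm (Fin (n₁ + n₂))) : ℝ :=
  permPValue (uStat Z W) (fun b => permutedUStat (Fin.append Z W) (π b))

end

/-! Write `Δ = ‖a - b‖²` for the squared distance of the two means, which equals `E[U]`, and `L =
log (1/(αβ))`. The event `U ≤ U^π` forces `U ≤ Δ/2` or `U^π ≥ Δ/2`. If each of these has probability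
at most `exp (1 - 2L) ≤ (3/8)αβ`, then Markov's inequality for the `p`-value
(`measureReal_permPValue_ge_le`), together with `1/(1+B) ≤ αβ/4`, gives `P(p_B ≥ α) ≤ β`. Both tails
come from Chernoff's bound at `t = 4L/Δ`, so everything rests on exponential moments of `U` and
`U^π`.

No comparability of the sample sizes is needed because `U` is an average, over ways to match the
first sample with distinct elements of the second, of one-sample forms `∑_{i≠j} ⟪V i, V j⟫` with `V
i = Z i - W (τ i)` (`uStat_eq_average_pairing`). By Jensen it suffices to treat one matching, where
the `V i` are independent with variance proxy `2σ²`. Such a form splits into a mean, a linear part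
and a centred chaos (`offDiagForm_add`). The chaos is decoupled into inner products of independent
partial sums (`offDiagForm_eq_average_split`), whose exponential moments follow by conditioning and
Gaussian linearization (`ExpMomentSubGaussian.expMoment_inner_le`); this produces the `√d`.

For `U^π`, exchanging the two members of any matched pair preserves the uniform law of the
permutation, so the differences acquire independent random signs (`sum_exp_permutedUStat_le`). Their
means are then `ε i * r i` times `a - b` with `|r i| ≤ 1`, and `(∑ ε i * r i)²` is of order `n₁`
instead of `n₁²`. The contribution of the means is therefore smaller than `Δ` by a factor of order
`n₁`, and `n₁ ≥ C L` makes it negligible after multiplication by `t`. -/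

/-- The exponential moment `E[exp f]`, as an extended nonnegative real. -/
noncomputable def expMoment {Ω : Type*} [MeasurableSpace Ω] (P : Measure Ω) (f : Ω → ℝ) :
    ENNReal :=
  ∫⁻ ω, ENNReal.ofReal (Real.exp (f ω)) ∂P

/-! ### Exponential moments: Chernoff and Jensen -/

section ExpMoment

variable {Ω : Type*} [MeasurableSpace Ω] {P : Measure Ω}

lemma measurable_ofReal_exp {f : Ω → ℝ} (hf : Measurable f) :
    Measurable fun ω => ENNReal.ofReal (Real.exp (f ω)) :=
  ENNReal.measurable_ofReal.comp (Real.measurable_exp.comp hf)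

lemma expMoment_mono {f g : Ω → ℝ} (h : ∀ ω, f ω ≤ g ω) : expMoment P f ≤ expMoment P g :=
  lintegral_mono fun ω => ENNReal.ofReal_le_ofReal (Real.exp_le_exp.2 (h ω))

lemma expMoment_const_add (a : ℝ) (f : Ω → ℝ) :
    expMoment P (fun ω => a + f ω) = ENNReal.ofReal (Real.exp a) * expMoment P f := by
  simp only [expMoment, Real.exp_add, ENNReal.ofReal_mul (Real.exp_pos a).le]
  rw [lintegral_const_mul' _ _ ENNReal.ofReal_ne_top]

/-- Chernoff's bound. -/
lemma measure_ge_le_expMoment {f : Ω → ℝ} (hf : Measurable f) (t : ℝ) :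
    P {ω | t ≤ f ω} ≤ ENNReal.ofReal (Real.exp (-t)) * expMoment P f := by
  have h := mul_meas_ge_le_lintegral (μ := P) (measurable_ofReal_exp hf)
    (ENNReal.ofReal (Real.exp t))
  have hs : {ω | ENNReal.ofReal (Real.exp t) ≤ ENNReal.ofReal (Real.exp (f ω))}
      = {ω | t ≤ f ω} := by
    ext ω
    simp [ENNReal.ofReal_le_ofReal_iff (Real.exp_pos _).le]
  rw [hs] at h
  calc P {ω | t ≤ f ω}
      = ENNReal.ofReal (Real.exp (-t)) * (ENNReal.ofReal (Real.exp t) * P {ω | t ≤ f ω}) := by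
        rw [← mul_assoc, ← ENNReal.ofReal_mul (Real.exp_pos _).le, ← Real.exp_add]
        simp
    _ ≤ _ := by gcongr; exact h

/-- Jensen's inequality for the exponential of a finite average. -/
lemma exp_average_le {κ : Type*} (s : Finset κ) (hs : s.Nonempty) (f : κ → ℝ) :
    Real.exp ((∑ k ∈ s, f k) / s.card) ≤ (∑ k ∈ s, Real.exp (f k)) / s.card := by
  have hc : (0 : ℝ) < s.card := by exact_mod_cast hs.card_pos
  have h := convexOn_exp.map_sum_le (t := s) (w := fun _ => (s.card : ℝ)⁻¹) (p := f)
    (fun _ _ => by positivity) (by simp [hc.ne']) (fun _ _ => Set.mem_univ _)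
  simpa [← Finset.mul_sum, div_eq_inv_mul] using h

/-- A finite average of uniformly bounded exponential moments bounds the exponential moment
of the average. -/
lemma expMoment_average_le {κ : Type*} (s : Finset κ) (hs : s.Nonempty) (f : κ → Ω → ℝ)
    (hf : ∀ k ∈ s, Measurable (f k)) (M : ENNReal) (hM : ∀ k ∈ s, expMoment P (f k) ≤ M) :
    expMoment P (fun ω => (∑ k ∈ s, f k ω) / s.card) ≤ M := by
  have hc : (0 : ℝ) < s.card := by exact_mod_cast hs.card_pos
  have hc' : (s.card : ENNReal) ≠ 0 := by exact_mod_cast hs.card_pos.ne'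
  calc expMoment P (fun ω => (∑ k ∈ s, f k ω) / s.card)
      ≤ ∫⁻ ω, (s.card : ENNReal)⁻¹ * ∑ k ∈ s, ENNReal.ofReal (Real.exp (f k ω)) ∂P := by
        refine lintegral_mono fun ω => ?_
        refine (ENNReal.ofReal_le_ofReal (exp_average_le s hs fun k => f k ω)).trans_eq ?_
        rw [div_eq_inv_mul, ENNReal.ofReal_mul (by positivity),
          ENNReal.ofReal_sum_of_nonneg (fun _ _ => (Real.exp_pos _).le),
          ENNReal.ofReal_inv_of_pos hc, ENNReal.ofReal_natCast]
    _ = (s.card : ENNReal)⁻¹ * ∑ k ∈ s, expMoment P (f k) := by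
        rw [lintegral_const_mul' _ _ (by simpa using hs.ne_empty),
          lintegral_finsetSum' _ fun k hk => (measurable_ofReal_exp (hf k hk)).aemeasurable]
        rfl
    _ ≤ (s.card : ENNReal)⁻¹ * (s.card * M) := by
        gcongr
        simpa using Finset.sum_le_card_nsmul s _ M hM
    _ = M := by
        rw [← mul_assoc, ENNReal.inv_mul_cancel hc' (by simp), one_mul]

/-- The exponential moment of a sum is controlled by those of the doubled summands. -/
lemma expMoment_add_le {f g : Ω → ℝ} (hf : Measurable f) (hg : Measurable g) {M : ENNReal}
    (hfM : expMoment P (fun ω => 2 * f ω) ≤ M) (hgM : expMoment P (fun ω => 2 * g ω) ≤ M) :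
    expMoment P (fun ω => f ω + g ω) ≤ M := by
  -- Since `f + g` is the average of `2f` and `2g`, Jensen applies and no independence of `f` and
  -- `g` is needed.
  have h := expMoment_average_le (P := P) Finset.univ Finset.univ_nonempty
    (fun (b : Bool) ω => if b then 2 * f ω else 2 * g ω)
    (fun b _ => by cases b <;> simp <;> fun_prop) M (fun b _ => by cases b <;> simpa)
  refine (expMoment_mono fun ω => ?_).trans h
  simp
  linarith

end ExpMoment

/-! ### Exponential moments of a standard Gaussian and of its square -/

section Gaussian

lemma expMoment_gaussian_linear (a : ℝ) :
    expMoment (gaussianReal 0 1) (fun g => a * g) = ENNReal.ofReal (Real.exp (a ^ 2 / 2)) := by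
  have h := congrFun (mgf_id_gaussianReal (μ := 0) (v := 1)) a
  rw [expMoment, ← ofReal_integral_eq_lintegral_ofReal]
  · change ENNReal.ofReal (mgf id (gaussianReal 0 1) a) = _
    rw [h]
    simp
  · simpa using integrable_exp_mul_gaussianReal (μ := 0) (v := 1) a
  · exact Filter.Eventually.of_forall fun _ => (Real.exp_pos _).le

/-- The moment is exactly `(1 - 2c)^(-1/2)`. Squaring reduces the bound to `1 ≤ (1 - 2c) exp (4c)`,
and `(1 - 2c)(1 + 4c) = 1 + 2c(1 - 4c) ≥ 1` when `c ≤ 1/4`. -/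
lemma expMoment_gaussian_sq_le {c : ℝ} (hc0 : 0 ≤ c) (hc : c ≤ 1 / 4) :
    expMoment (gaussianReal 0 1) (fun g => c * g ^ 2) ≤ ENNReal.ofReal (Real.exp (2 * c)) := by
  have hb : 0 < 1 / 2 - c := by linarith
  have hpt : ∀ x : ℝ, gaussianPDF 0 1 x * ENNReal.ofReal (Real.exp (c * x ^ 2))
      = ENNReal.ofReal ((Real.sqrt (2 * Real.pi))⁻¹ * Real.exp (-(1 / 2 - c) * x ^ 2)) := by
    intro x
    rw [gaussianPDF, ← ENNReal.ofReal_mul (gaussianPDFReal_nonneg _ _ _), gaussianPDFReal]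
    congr 1
    rw [mul_assoc, ← Real.exp_add]
    simp
    ring_nf
    simp
  rw [expMoment, gaussianReal_of_var_ne_zero _ one_ne_zero,
    lintegral_withDensity_eq_lintegral_mul _ (measurable_gaussianPDF _ _)
      (measurable_ofReal_exp (by fun_prop))]
  simp only [Pi.mul_apply, hpt]
  rw [← ofReal_integral_eq_lintegral_ofReal ((integrable_exp_neg_mul_sq hb).const_mul _)
    (Filter.Eventually.of_forall fun _ => by positivity)]
  refine ENNReal.ofReal_le_ofReal ?_
  rw [integral_const_mul, integral_gaussian, ← Real.sqrt_inv, ← Real.sqrt_mul (by positivity)]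
  have : (2 * Real.pi)⁻¹ * (Real.pi / (1 / 2 - c)) = 1 / (1 - 2 * c) := by
    have := Real.pi_pos.ne'
    have h2 : (1 - 2 * c) ≠ 0 := by linarith
    have h3 : (1 / 2 - c) ≠ 0 := by linarith
    field_simp
  rw [this, Real.sqrt_le_left (Real.exp_pos _).le, ← Real.exp_nat_mul,
    div_le_iff₀ (by linarith)]
  have h1 := Real.add_one_le_exp (((2 : ℕ) : ℝ) * (2 * c))
  push_cast at h1 ⊢
  nlinarith

end Gaussian

section Independent

variable {Ω : Type*} [MeasurableSpace Ω] {P : Measure Ω}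

/-- The exponential moment of a sum of independent variables is the product of theirs. -/
lemma expMoment_sum_of_iIndepFun {κ : Type*} (s : Finset κ) {X : κ → Ω → ℝ} (hX : iIndepFun X P)
    (hXm : ∀ k, Measurable (X k)) :
    expMoment P (fun ω => ∑ k ∈ s, X k ω) = ∏ k ∈ s, expMoment P (X k) := by
  simp only [expMoment, Real.exp_sum, ENNReal.ofReal_prod_of_nonneg
    fun _ _ => (Real.exp_pos _).le]
  exact lintegral_prod_eq_prod_lintegral_of_indepFun s
    (fun k ω => ENNReal.ofReal (Real.exp (X k ω)))
    (hX.comp (fun _ x => ENNReal.ofReal (Real.exp x))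
      fun _ => measurable_ofReal_exp measurable_id)
    fun k => measurable_ofReal_exp (hXm k)

end Independent

/-! ### Squared norms and inner products of sub-Gaussian vectors -/

section SubGaussian

variable {Ω : Type*} [MeasurableSpace Ω] {P : Measure Ω} {ι : Type*} [Fintype ι]

/-- The exponential moments of the linear forms of the random vector `X` are bounded as those of
a centred Gaussian vector with covariance `s • 1`. -/
def ExpMomentSubGaussian (P : Measure Ω) (X : Ω → EuclideanSpace ℝ ι) (s : ℝ) : Prop :=
  ∀ v : EuclideanSpace ℝ ι,
    expMoment P (fun ω => inner ℝ v (X ω)) ≤ ENNReal.ofReal (Real.exp (s * ‖v‖ ^ 2 / 2))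

lemma expMoment_pi_gaussian (f : ι → ℝ → ℝ) (hf : ∀ k, Measurable (f k)) :
    expMoment (Measure.pi fun _ : ι => gaussianReal 0 1) (fun g => ∑ k, f k (g k))
      = ∏ k, expMoment (gaussianReal 0 1) (f k) := by
  rw [expMoment_sum_of_iIndepFun Finset.univ (X := fun k (g : ι → ℝ) => f k (g k))
    (iIndepFun_pi fun k => (hf k).aemeasurable)
    (fun k => (hf k).comp (measurable_pi_apply k))]
  refine Finset.prod_congr rfl fun k _ => ?_
  exact (measurePreserving_eval (fun _ : ι => gaussianReal 0 1) k).lintegral_comp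
    (measurable_ofReal_exp (hf k))

/-- Gaussian linearization of a squared norm. -/
lemma ofReal_exp_norm_sq_eq_expMoment {c : ℝ} (hc : 0 ≤ c) (x : EuclideanSpace ℝ ι) :
    ENNReal.ofReal (Real.exp (c * ‖x‖ ^ 2))
      = expMoment (Measure.pi fun _ : ι => gaussianReal 0 1)
        (fun g => inner ℝ (Real.sqrt (2 * c) • WithLp.toLp 2 g) x) := by
  have h1 : (fun g : ι → ℝ => inner ℝ (Real.sqrt (2 * c) • WithLp.toLp 2 g) x)
      = fun g => ∑ k, (Real.sqrt (2 * c) * x k) * g k := by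
    funext g
    rw [real_inner_smul_left, PiLp.inner_apply, Finset.mul_sum]
    refine Finset.sum_congr rfl fun k _ => ?_
    simp
    ring
  rw [h1, expMoment_pi_gaussian (fun k g => (Real.sqrt (2 * c) * x k) * g)
    (fun k => by fun_prop)]
  simp only [expMoment_gaussian_linear]
  rw [← ENNReal.ofReal_prod_of_nonneg fun _ _ => (Real.exp_pos _).le, ← Real.exp_sum,
    EuclideanSpace.real_norm_sq_eq, Finset.mul_sum]
  congr 2
  refine Finset.sum_congr rfl fun k _ => ?_
  rw [mul_pow, Real.sq_sqrt (by positivity)]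
  ring

/-- The square of the norm of a sub-Gaussian vector has exponential moments. -/
lemma ExpMomentSubGaussian.expMoment_norm_sq_le [SFinite P] {X : Ω → EuclideanSpace ℝ ι} {s : ℝ}
    (hX : ExpMomentSubGaussian P X s) (hXm : Measurable X) (hs : 0 ≤ s) {c : ℝ} (hc : 0 ≤ c)
    (hcs : c * s ≤ 1 / 4) :
    expMoment P (fun ω => c * ‖X ω‖ ^ 2)
      ≤ ENNReal.ofReal (Real.exp (2 * (c * s) * Fintype.card ι)) := by
  have hm : Measurable fun p : Ω × (ι → ℝ) =>
      (inner ℝ (Real.sqrt (2 * c) • WithLp.toLp 2 p.2) (X p.1) : ℝ) := by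
    fun_prop
  calc expMoment P (fun ω => c * ‖X ω‖ ^ 2)
      = ∫⁻ ω, ∫⁻ g, ENNReal.ofReal (Real.exp
          (inner ℝ (Real.sqrt (2 * c) • WithLp.toLp 2 g) (X ω)))
          ∂(Measure.pi fun _ : ι => gaussianReal 0 1) ∂P := by
        exact lintegral_congr fun ω => ofReal_exp_norm_sq_eq_expMoment hc (X ω)
    -- By Tonelli the data are integrated first, with the Gaussian vector frozen; only a linear form
    -- of `X` then has to be controlled.
    _ = ∫⁻ g, ∫⁻ ω, ENNReal.ofReal (Real.exp
          (inner ℝ (Real.sqrt (2 * c) • WithLp.toLp 2 g) (X ω))) ∂P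
          ∂(Measure.pi fun _ : ι => gaussianReal 0 1) :=
        lintegral_lintegral_swap (measurable_ofReal_exp hm).aemeasurable
    _ ≤ expMoment (Measure.pi fun _ : ι => gaussianReal 0 1)
          (fun g => ∑ k, (c * s) * g k ^ 2) := by
        refine lintegral_mono fun g => (hX _).trans_eq ?_
        beta_reduce
        rw [norm_smul, mul_pow, EuclideanSpace.real_norm_sq_eq, ← Finset.mul_sum,
          Real.norm_of_nonneg (Real.sqrt_nonneg _), Real.sq_sqrt (by positivity)]
        congr 2
        ring
    _ = ∏ _k : ι, expMoment (gaussianReal 0 1) (fun g => (c * s) * g ^ 2) :=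
        expMoment_pi_gaussian (fun _ g => (c * s) * g ^ 2) (fun _ => by fun_prop)
    _ ≤ ∏ _k : ι, ENNReal.ofReal (Real.exp (2 * (c * s))) :=
        Finset.prod_le_prod' fun _ _ => expMoment_gaussian_sq_le (by positivity) hcs
    _ = _ := by
        rw [Finset.prod_const, ← ENNReal.ofReal_pow (Real.exp_pos _).le, ← Real.exp_nat_mul,
          Finset.card_univ]
        congr 2
        ring

/-- Exponential moments of the inner product of two independent sub-Gaussian vectors. -/
lemma ExpMomentSubGaussian.expMoment_inner_le [IsProbabilityMeasure P]
    {X Y : Ω → EuclideanSpace ℝ ι} {s t : ℝ}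
    (hX : ExpMomentSubGaussian P X s) (hY : ExpMomentSubGaussian P Y t)
    (hXm : Measurable X) (hYm : Measurable Y) (hXY : IndepFun X Y P) (hs : 0 ≤ s) (ht : 0 ≤ t)
    {l : ℝ} (hl : l ^ 2 * (s * t) ≤ 1 / 2) :
    expMoment P (fun ω => l * inner ℝ (X ω) (Y ω))
      ≤ ENNReal.ofReal (Real.exp (l ^ 2 * (s * t) * Fintype.card ι)) := by
  have hm : Measurable fun p : EuclideanSpace ℝ ι × EuclideanSpace ℝ ι =>
      l * inner ℝ p.1 p.2 := by fun_prop
  have hm2 := measurable_ofReal_exp hm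
  calc expMoment P (fun ω => l * inner ℝ (X ω) (Y ω))
      = ∫⁻ p, ENNReal.ofReal (Real.exp (l * inner ℝ p.1 p.2)) ∂(P.map fun ω => (X ω, Y ω)) := by
        rw [lintegral_map hm2 (hXm.prodMk hYm)]
        rfl
    _ = ∫⁻ x, ∫⁻ y, ENNReal.ofReal (Real.exp (l * inner ℝ x y)) ∂(P.map Y) ∂(P.map X) := by
        rw [(indepFun_iff_map_prod_eq_prod_map_map hXm.aemeasurable hYm.aemeasurable).1 hXY,
          lintegral_prod _ hm2.aemeasurable]
    _ = ∫⁻ ω, ∫⁻ y, ENNReal.ofReal (Real.exp (l * inner ℝ (X ω) y)) ∂(P.map Y) ∂P := by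
        have : IsProbabilityMeasure (P.map Y) := Measure.isProbabilityMeasure_map hYm.aemeasurable
        rw [lintegral_map hm2.lintegral_prod_right' hXm]
    -- Conditionally on `X`, the variable is the linear form of `Y` in the direction `l • X`.
    _ ≤ expMoment P (fun ω => (l ^ 2 * t / 2) * ‖X ω‖ ^ 2) := by
        refine lintegral_mono fun ω => ?_
        have hy : Measurable fun y : EuclideanSpace ℝ ι => l * inner ℝ (X ω) y := by fun_prop
        rw [lintegral_map (measurable_ofReal_exp hy) hYm]
        have := hY (l • X ω)
        simp only [real_inner_smul_left] at this
        refine this.trans_eq ?_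
        rw [norm_smul, mul_pow, Real.norm_eq_abs, sq_abs]
        congr 2
        ring
    _ ≤ ENNReal.ofReal (Real.exp (2 * ((l ^ 2 * t / 2) * s) * Fintype.card ι)) :=
        hX.expMoment_norm_sq_le hXm hs (by positivity) (by linarith)
    _ = _ := by
        congr 2
        ring

end SubGaussian

/-! ### Off-diagonal quadratic forms and decoupling -/

section OffDiag

variable {κ : Type*} [Fintype κ] [DecidableEq κ] {F : Type*} [NormedAddCommGroup F]
  [InnerProductSpace ℝ F]

/-- The off-diagonal quadratic form `∑_{i ≠ j} ⟪V i, V j⟫`. -/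
noncomputable def offDiagForm (V : κ → F) : ℝ :=
  ∑ p ∈ (Finset.univ : Finset κ).offDiag, inner ℝ (V p.1) (V p.2)

lemma offDiagForm_eq_norm_sq_sub (V : κ → F) :
    offDiagForm V = ‖∑ i, V i‖ ^ 2 - ∑ i, ‖V i‖ ^ 2 := by
  have h : ‖∑ i, V i‖ ^ 2
      = ∑ p ∈ (Finset.univ : Finset κ) ×ˢ Finset.univ, inner ℝ (V p.1) (V p.2) := by
    rw [← real_inner_self_eq_norm_sq, sum_inner, Finset.sum_product]
    simp only [inner_sum]
  rw [h, ← Finset.diag_union_offDiag, Finset.sum_union (Finset.disjoint_diag_offDiag _),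
    Finset.sum_diag]
  simp only [real_inner_self_eq_norm_sq, offDiagForm]
  ring

/-- This separates the deterministic mean, a linear form in the noise and a pure chaos; each noise
vector is paired with the sum of the other means. -/
lemma offDiagForm_add (m V : κ → F) :
    offDiagForm (fun i => m i + V i)
      = offDiagForm m + 2 * ∑ i, inner ℝ (∑ j, m j - m i) (V i) + offDiagForm V := by
  simp only [offDiagForm_eq_norm_sq_sub, Finset.sum_add_distrib, norm_add_sq_real,
    inner_sub_left, Finset.sum_sub_distrib, ← Finset.mul_sum, inner_sum]
  ring

/-- The real value of a sign. -/
def signVal (u : ℤˣ) : ℝ := ((u : ℤ) : ℝ)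

@[simp] lemma signVal_one : signVal 1 = 1 := by simp [signVal]

@[simp] lemma signVal_neg_one : signVal (-1) = -1 := by simp [signVal]

lemma signVal_mul (u v : ℤˣ) : signVal (u * v) = signVal u * signVal v := by simp [signVal]

lemma abs_signVal (u : ℤˣ) : |signVal u| = 1 := by
  rcases Int.units_eq_one_or u with rfl | rfl <;> simp

/-- Flipping the `i`-th sign is a bijection of the sign vectors that negates the sum. -/
lemma sum_signVal_mul_signVal {i j : κ} (hij : i ≠ j) :
    ∑ ε : κ → ℤˣ, signVal (ε i) * signVal (ε j) = 0 := by
  have h := Equiv.sum_comp (Equiv.mulLeft (Pi.mulSingle i (-1) : κ → ℤˣ))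
    (fun ε : κ → ℤˣ => signVal (ε i) * signVal (ε j))
  simp only [Equiv.coe_mulLeft, Pi.mul_apply, Pi.mulSingle_eq_same,
    Pi.mulSingle_eq_of_ne hij.symm, one_mul, signVal_mul, signVal_neg_one] at h
  simp only [neg_mul, one_mul, Finset.sum_neg_distrib] at h
  linarith

/-- Parseval's identity for random signs. -/
lemma sum_norm_sq_signed_sum (V : κ → F) :
    ∑ ε : κ → ℤˣ, ‖∑ i, signVal (ε i) • V i‖ ^ 2
      = Fintype.card (κ → ℤˣ) * ∑ i, ‖V i‖ ^ 2 := by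
  have h : ∀ ε : κ → ℤˣ, ‖∑ i, signVal (ε i) • V i‖ ^ 2
      = ∑ p ∈ (Finset.univ : Finset κ).offDiag,
        signVal (ε p.1) * signVal (ε p.2) * inner ℝ (V p.1) (V p.2) + ∑ i, ‖V i‖ ^ 2 := by
    intro ε
    have h1 := offDiagForm_eq_norm_sq_sub fun i => signVal (ε i) • V i
    have h2 : ∀ i, ‖signVal (ε i) • V i‖ ^ 2 = ‖V i‖ ^ 2 := fun i => by
      rw [norm_smul, Real.norm_eq_abs, abs_signVal, one_mul]
    simp only [h2] at h1
    rw [← sub_eq_iff_eq_add, ← h1, offDiagForm]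
    refine Finset.sum_congr rfl fun p _ => ?_
    rw [real_inner_smul_left, real_inner_smul_right]
    ring
  simp only [h, Finset.sum_add_distrib, Finset.sum_const, Finset.card_univ, nsmul_eq_mul]
  rw [Finset.sum_comm, Finset.sum_eq_zero, zero_add]
  intro p hp
  rw [← Finset.sum_mul, sum_signVal_mul_signVal (Finset.mem_offDiag.1 hp).2.2, zero_mul]

/-- Decoupling: the off-diagonal form is the average, over all ways to split the index set, of
four times the inner product of the two partial sums. -/
lemma offDiagForm_eq_average_split (V : κ → F) :
    offDiagForm V = (∑ ε : κ → ℤˣ, 4 * inner ℝ (∑ i with ε i = 1, V i) (∑ i with ¬ ε i = 1, V i))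
      / (Finset.univ : Finset (κ → ℤˣ)).card := by
  -- Polarization, `4⟪A, B⟫ = ‖A + B‖² - ‖A - B‖²`, where `A - B` is the signed sum. Averaging and
  -- Parseval turn the last term into `∑ ‖V i‖²`.
  have h : ∀ ε : κ → ℤˣ,
      4 * inner ℝ (∑ i with ε i = 1, V i) (∑ i with ¬ ε i = 1, V i)
        = ‖∑ i, V i‖ ^ 2 - ‖∑ i, signVal (ε i) • V i‖ ^ 2 := by
    intro ε
    have h1 : ∑ i, V i = ∑ i with ε i = 1, V i + ∑ i with ¬ ε i = 1, V i :=
      (Finset.sum_filter_add_sum_filter_not _ _ _).symm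
    have h2 : ∑ i, signVal (ε i) • V i
        = ∑ i with ε i = 1, V i - ∑ i with ¬ ε i = 1, V i := by
      rw [← Finset.sum_filter_add_sum_filter_not Finset.univ (fun i => ε i = 1), sub_eq_add_neg,
        ← Finset.sum_neg_distrib]
      congr 1 <;> refine Finset.sum_congr rfl fun i hi => ?_
      · simp [(Finset.mem_filter.1 hi).2]
      · simp [(Int.units_eq_one_or (ε i)).resolve_left (Finset.mem_filter.1 hi).2]
    rw [h1, h2, norm_add_sq_real, norm_sub_sq_real]
    ring
  have hc : ((Fintype.card (κ → ℤˣ) : ℕ) : ℝ) ≠ 0 := by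
    exact_mod_cast Fintype.card_ne_zero
  simp only [h, Finset.sum_sub_distrib, sum_norm_sq_signed_sum, Finset.sum_const, nsmul_eq_mul,
    offDiagForm_eq_norm_sq_sub, Finset.card_univ]
  field_simp

end OffDiag

/-! ### Exponential moments of off-diagonal forms -/

section Chaos

variable {Ω : Type*} [MeasurableSpace Ω] {P : Measure Ω} {ι κ : Type*} [Fintype ι] [Fintype κ]
  [DecidableEq κ]

/-- A family of random vectors whose linear combinations are sub-Gaussian, and whose partial sums
over complementary sets of indices are independent. -/
structure SplitSubGaussian (P : Measure Ω) (η : κ → Ω → EuclideanSpace ℝ ι) (s : ℝ) : Prop where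
  measurable : ∀ k, Measurable (η k)
  expMoment_linear_le : ∀ c : κ → EuclideanSpace ℝ ι,
    expMoment P (fun ω => ∑ k, inner ℝ (c k) (η k ω))
      ≤ ENNReal.ofReal (Real.exp (s * (∑ k, ‖c k‖ ^ 2) / 2))
  indepFun : ∀ S T : Finset κ, Disjoint S T →
    IndepFun (fun ω => ∑ k ∈ S, η k ω) (fun ω => ∑ k ∈ T, η k ω) P

variable {η : κ → Ω → EuclideanSpace ℝ ι} {s : ℝ}

lemma SplitSubGaussian.sum (h : SplitSubGaussian P η s) (S : Finset κ) :
    ExpMomentSubGaussian P (fun ω => ∑ k ∈ S, η k ω) (S.card * s) := by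
  intro v
  have h1 := h.expMoment_linear_le fun k => if k ∈ S then v else 0
  have h2 : ∀ ω, ∑ k, inner ℝ (if k ∈ S then v else 0) (η k ω)
      = inner ℝ v (∑ k ∈ S, η k ω) := by
    intro ω
    have : ∀ k, inner ℝ (if k ∈ S then v else 0) (η k ω)
        = if k ∈ S then inner ℝ v (η k ω) else 0 := fun k => by split_ifs <;> simp
    simp only [this, inner_sum, Finset.sum_ite_mem, Finset.univ_inter]
  have h3 : ∑ k, ‖if k ∈ S then v else 0‖ ^ 2 = S.card * ‖v‖ ^ 2 := by
    have : ∀ k, ‖if k ∈ S then v else 0‖ ^ 2 = if k ∈ S then ‖v‖ ^ 2 else 0 :=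
      fun k => by split_ifs <;> simp
    simp only [this, Finset.sum_ite_mem, Finset.univ_inter, Finset.sum_const, nsmul_eq_mul]
  simp only [h2, h3] at h1
  refine h1.trans_eq ?_
  congr 2
  ring

/-- Exponential moments of the off-diagonal form of centred vectors. -/
lemma SplitSubGaussian.expMoment_offDiagForm_le [IsProbabilityMeasure P]
    (h : SplitSubGaussian P η s) (hs : 0 ≤ s) {l : ℝ}
    (hl : 8 * (l ^ 2 * s ^ 2 * (Fintype.card κ : ℝ) ^ 2) ≤ 1) :
    expMoment P (fun ω => l * offDiagForm fun k => η k ω)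
      ≤ ENNReal.ofReal (Real.exp
        (4 * (l ^ 2 * s ^ 2 * (Fintype.card κ : ℝ) ^ 2) * Fintype.card ι)) := by
  have hm := h.measurable
  have hsum : ∀ S : Finset κ, Measurable fun ω => ∑ k ∈ S, η k ω :=
    fun S => Finset.measurable_sum S fun k _ => hm k
  have h0 : (fun ω => l * offDiagForm fun k => η k ω)
      = fun ω => (∑ ε : κ → ℤˣ, (4 * l) *
        inner ℝ (∑ i with ε i = 1, η i ω) (∑ i with ¬ ε i = 1, η i ω))
        / (Finset.univ : Finset (κ → ℤˣ)).card := by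
    funext ω
    rw [offDiagForm_eq_average_split, ← mul_div_assoc, Finset.mul_sum]
    congr 1
    refine Finset.sum_congr rfl fun ε _ => ?_
    ring
  rw [h0]
  refine expMoment_average_le _ Finset.univ_nonempty _
    (fun ε _ => ((hsum _).inner (hsum _)).const_mul _) _ fun ε _ => ?_
  set S := Finset.univ.filter fun i => ε i = 1
  set T := Finset.univ.filter fun i => ¬ ε i = 1
  have hcard : (S.card : ℝ) + T.card = Fintype.card κ := by
    have := Finset.card_filter_add_card_filter_not (s := (Finset.univ : Finset κ))
      (fun i => ε i = 1)
    rw [Finset.card_univ] at this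
    exact_mod_cast this
  -- This is `4 |S| |T| ≤ (|S| + |T|)²`.
  have hprod : (4 * l) ^ 2 * ((S.card * s) * (T.card * s))
      ≤ 4 * (l ^ 2 * s ^ 2 * (Fintype.card κ : ℝ) ^ 2) := by
    rw [← hcard]
    have := mul_nonneg (mul_nonneg (sq_nonneg l) (sq_nonneg s))
      (sq_nonneg ((S.card : ℝ) - T.card))
    nlinarith
  refine ((h.sum S).expMoment_inner_le (h.sum T) (hsum S) (hsum T)
    (h.indepFun S T (Finset.disjoint_filter_filter_not _ _ _)) (by positivity) (by positivity)
    (hprod.trans (by linarith))).trans ?_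
  gcongr

/-- Exponential moments of the off-diagonal form of vectors with means `m`. -/
lemma SplitSubGaussian.expMoment_offDiagForm_add_le [IsProbabilityMeasure P]
    (h : SplitSubGaussian P η s) (hs : 0 ≤ s) (m : κ → EuclideanSpace ℝ ι) {l : ℝ}
    (hl : 32 * (l ^ 2 * s ^ 2 * (Fintype.card κ : ℝ) ^ 2) ≤ 1) :
    expMoment P (fun ω => l * offDiagForm fun k => m k + η k ω)
      ≤ ENNReal.ofReal (Real.exp (l * offDiagForm m
        + (8 * (l ^ 2 * s) * ∑ k, ‖∑ j, m j - m k‖ ^ 2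
        + 16 * (l ^ 2 * s ^ 2 * (Fintype.card κ : ℝ) ^ 2) * Fintype.card ι))) := by
  have hm := h.measurable
  have h0 : (fun ω => l * offDiagForm fun k => m k + η k ω)
      = fun ω => l * offDiagForm m + (2 * l * ∑ k, inner ℝ (∑ j, m j - m k) (η k ω)
        + l * offDiagForm fun k => η k ω) := by
    funext ω
    rw [offDiagForm_add]
    ring
  rw [h0, expMoment_const_add, Real.exp_add, ENNReal.ofReal_mul (Real.exp_pos _).le]
  gcongr
  -- Both noise parts are doubled. The linear form then has coefficients `4l`, giving `(4l)² s / 2 =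
  -- 8 l² s`, and the chaos has parameter `2l`, which turns the constants `8` and `4` into `32` and
  -- `16`.
  refine expMoment_add_le ?_ ?_ ?_ ?_
  · exact (Finset.measurable_sum _ fun k _ => (hm k).const_inner).const_mul _
  · simp only [offDiagForm]
    exact (Finset.measurable_sum _ fun p _ => (hm _).inner (hm _)).const_mul _
  · have h1 := h.expMoment_linear_le fun k => (4 * l) • (∑ j, m j - m k)
    have h2 : ∀ ω, ∑ k, inner ℝ ((4 * l) • (∑ j, m j - m k)) (η k ω)
        = 2 * (2 * l * ∑ k, inner ℝ (∑ j, m j - m k) (η k ω)) := by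
      intro ω
      simp only [real_inner_smul_left, ← Finset.mul_sum]
      ring
    simp only [h2] at h1
    refine h1.trans (ENNReal.ofReal_le_ofReal (Real.exp_le_exp.2 ?_))
    simp only [norm_smul, mul_pow, ← Finset.mul_sum, Real.norm_eq_abs, sq_abs]
    have : 0 ≤ 16 * (l ^ 2 * s ^ 2 * (Fintype.card κ : ℝ) ^ 2) * Fintype.card ι := by positivity
    linarith
  · have h1 := h.expMoment_offDiagForm_le hs (l := 2 * l) (by linarith)
    simp only [mul_assoc 2 l] at h1
    refine h1.trans (ENNReal.ofReal_le_ofReal (Real.exp_le_exp.2 ?_))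
    have : 0 ≤ 8 * (l ^ 2 * s) * ∑ k, ‖∑ j, m j - m k‖ ^ 2 := by positivity
    linarith

end Chaos

/-! ### Weighted sums of random signs -/

section RandomSigns

variable {κ : Type*} [Fintype κ] [DecidableEq κ]

/-- Hoeffding's bound for the exponential moments of a weighted sum of random signs. -/
lemma sum_exp_signed_sum_le (a : κ → ℝ) :
    ∑ ε : κ → ℤˣ, Real.exp (∑ k, signVal (ε k) * a k)
      ≤ Fintype.card (κ → ℤˣ) * Real.exp ((∑ k, a k ^ 2) / 2) := by
  have h := Finset.prod_univ_sum (fun _ : κ => (Finset.univ : Finset ℤˣ))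
    fun k u => Real.exp (signVal u * a k)
  rw [Fintype.piFinset_univ] at h
  simp only [Real.exp_sum, ← h]
  have h1 : ∀ k, ∑ u : ℤˣ, Real.exp (signVal u * a k) = 2 * Real.cosh (a k) := by
    intro k
    rw [show (Finset.univ : Finset ℤˣ) = {1, -1} from rfl, Finset.sum_pair (by decide),
      Real.cosh_eq]
    simp
    ring
  simp only [h1, Finset.prod_mul_distrib]
  have h2 : (Fintype.card (κ → ℤˣ) : ℝ) = ∏ _k : κ, (2 : ℝ) := by simp
  rw [h2, Finset.sum_div, Real.exp_sum]
  gcongr with k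
  exact Real.cosh_le_exp_half_sq _

/-- Exponential moments of the square of a weighted sum of random signs. -/
lemma sum_exp_sq_signed_sum_le {r : κ → ℝ} (hr : ∀ k, |r k| ≤ 1) {c : ℝ} (hc : 0 ≤ c)
    (hcn : c * Fintype.card κ ≤ 1 / 4) :
    ∑ ε : κ → ℤˣ, ENNReal.ofReal (Real.exp (c * (∑ k, signVal (ε k) * r k) ^ 2))
      ≤ Fintype.card (κ → ℤˣ) * ENNReal.ofReal (Real.exp (2 * (c * Fintype.card κ))) := by
  -- Gaussian linearization of the square leaves, for each fixed `g`, a linear form in the signs, to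
  -- which Hoeffding's bound applies.
  have h1 : ∀ R : ℝ, ENNReal.ofReal (Real.exp (c * R ^ 2))
      = expMoment (gaussianReal 0 1) (fun g => Real.sqrt (2 * c) * R * g) := by
    intro R
    rw [expMoment_gaussian_linear, mul_pow, Real.sq_sqrt (by positivity)]
    congr 2
    ring
  simp only [h1, expMoment]
  rw [← lintegral_finsetSum _ fun ε _ => measurable_ofReal_exp (by fun_prop)]
  calc _ ≤ ∫⁻ g, Fintype.card (κ → ℤˣ) * ENNReal.ofReal (Real.exp
          ((c * Fintype.card κ) * g ^ 2)) ∂(gaussianReal 0 1) := by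
        refine lintegral_mono fun g => ?_
        rw [← ENNReal.ofReal_sum_of_nonneg fun _ _ => (Real.exp_pos _).le,
          ← ENNReal.ofReal_natCast, ← ENNReal.ofReal_mul (by positivity)]
        refine ENNReal.ofReal_le_ofReal ?_
        have h2 := sum_exp_signed_sum_le fun k => Real.sqrt (2 * c) * g * r k
        have h3 : ∀ ε : κ → ℤˣ, ∑ k, signVal (ε k) * (Real.sqrt (2 * c) * g * r k)
            = Real.sqrt (2 * c) * (∑ k, signVal (ε k) * r k) * g := by
          intro ε
          rw [Finset.mul_sum, Finset.sum_mul]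
          exact Finset.sum_congr rfl fun k _ => by ring
        simp only [h3] at h2
        refine h2.trans ?_
        gcongr
        have h4 : ∑ k, (Real.sqrt (2 * c) * g * r k) ^ 2 ≤ ∑ _k : κ, 2 * c * g ^ 2 := by
          gcongr with k
          rw [mul_pow, mul_pow, Real.sq_sqrt (by positivity)]
          have := (sq_le_one_iff_abs_le_one (r k)).2 (hr k)
          nlinarith [mul_nonneg hc (sq_nonneg g)]
        rw [Finset.sum_const, Finset.card_univ, nsmul_eq_mul] at h4
        linarith
    _ = Fintype.card (κ → ℤˣ) * expMoment (gaussianReal 0 1)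
          (fun g => (c * Fintype.card κ) * g ^ 2) := by
        rw [lintegral_const_mul' _ _ (by simp)]
        rfl
    _ ≤ _ := by
        gcongr
        exact expMoment_gaussian_sq_le (by positivity) hcn

end RandomSigns

/-! ### Averaging over matchings and introducing random signs -/

section Permutations

lemma exists_perm_map_pair {κ : Type*} [DecidableEq κ] {i j k l : κ} (hij : i ≠ j) (hkl : k ≠ l) :
    ∃ σ : Equiv.Perm κ, σ i = k ∧ σ j = l :=
  MulAction.is_two_pretransitive_iff.1 (Equiv.Perm.isMultiplyPretransitive κ 2) hij hkl

/-- The image of a pair of distinct points under a uniformly random permutation is uniformly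
distributed on the pairs of distinct points. -/
lemma sum_perm_apply_pair {κ : Type*} [Fintype κ] [DecidableEq κ] (f : κ → κ → ℝ) {i j : κ}
    (hij : i ≠ j) :
    (∑ τ : Equiv.Perm κ, f (τ i) (τ j)) * ((Fintype.card κ : ℝ) * ((Fintype.card κ : ℝ) - 1))
      = Fintype.card (Equiv.Perm κ) * ∑ q ∈ (Finset.univ : Finset κ).offDiag, f q.1 q.2 := by
  -- By 2-transitivity the sum over permutations is the same for every pair of distinct points, so
  -- it can be computed by summing over all pairs as well.
  have h1 : ∀ p ∈ (Finset.univ : Finset κ).offDiag,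
      ∑ τ : Equiv.Perm κ, f (τ p.1) (τ p.2) = ∑ τ : Equiv.Perm κ, f (τ i) (τ j) := by
    intro p hp
    obtain ⟨σ, hσ1, hσ2⟩ := exists_perm_map_pair (Finset.mem_offDiag.1 hp).2.2 hij
    rw [← Equiv.sum_comp (Equiv.mulRight σ)]
    simp [hσ1, hσ2]
  have h2 : ∀ τ : Equiv.Perm κ, ∑ p ∈ (Finset.univ : Finset κ).offDiag, f (τ p.1) (τ p.2)
      = ∑ q ∈ (Finset.univ : Finset κ).offDiag, f q.1 q.2 := by
    intro τ
    refine Finset.sum_equiv (τ.prodCongr τ) (fun p => ?_) fun p _ => rfl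
    simp
  have h3 := Finset.sum_congr rfl h1
  rw [Finset.sum_comm, Finset.sum_congr rfl fun τ _ => h2 τ] at h3
  simp only [Finset.sum_const, Finset.offDiag_card, Finset.card_univ, nsmul_eq_mul] at h3
  rw [h3, Nat.cast_sub (Nat.le_mul_self _)]
  push_cast
  ring

variable {d n₁ n₂ : ℕ}

/-- The two-sample statistic is the average of paired one-sample statistics over all ways to pair
the first sample with distinct elements of the second. -/
lemma uStat_eq_average_pairing (hn : n₁ ≤ n₂) (hn₂ : 2 ≤ n₂)
    (Z : Fin n₁ → EuclideanSpace ℝ (Fin d)) (W : Fin n₂ → EuclideanSpace ℝ (Fin d)) :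
    uStat Z W = (∑ τ : Equiv.Perm (Fin n₂), 1 / ((n₁ : ℝ) * ((n₁ : ℝ) - 1)) *
      offDiagForm fun i => Z i - W (τ (Fin.castLE hn i)))
        / (Finset.univ : Finset (Equiv.Perm (Fin n₂))).card := by
  have hc : ((Fintype.card (Equiv.Perm (Fin n₂)) : ℕ) : ℝ) ≠ 0 := by
    exact_mod_cast Fintype.card_ne_zero
  have h2 : (n₂ : ℝ) * ((n₂ : ℝ) - 1) ≠ 0 := by
    have : (2 : ℝ) ≤ n₂ := by exact_mod_cast hn₂
    have h' : (n₂ : ℝ) - 1 ≠ 0 := by linarith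
    positivity
  have h : ∀ p ∈ (Finset.univ : Finset (Fin n₁)).offDiag,
      ∑ q ∈ (Finset.univ : Finset (Fin n₂)).offDiag, inner ℝ (Z p.1 - W q.1) (Z p.2 - W q.2)
      = (∑ τ : Equiv.Perm (Fin n₂), inner ℝ (Z p.1 - W (τ (Fin.castLE hn p.1)))
          (Z p.2 - W (τ (Fin.castLE hn p.2)))) * ((n₂ : ℝ) * ((n₂ : ℝ) - 1))
          / Fintype.card (Equiv.Perm (Fin n₂)) := by
    intro p hp
    have := sum_perm_apply_pair (fun k l => inner ℝ (Z p.1 - W k) (Z p.2 - W l))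
      ((Fin.castLE_injective hn).ne (Finset.mem_offDiag.1 hp).2.2)
    rw [Fintype.card_fin] at this
    rw [this, mul_div_cancel_left₀ _ hc]
  rw [uStat, Finset.sum_congr rfl h, ← Finset.sum_div, ← Finset.sum_mul, Finset.sum_comm,
    Finset.card_univ, ← Finset.mul_sum]
  simp only [offDiagForm]
  have h3 : (n₂ : ℝ) - 1 ≠ 0 := right_ne_zero_of_mul h2
  field_simp

/-- The permutation of the pooled indices that permutes the second block by `τ`. -/
def permSecondBlock (n₁ : ℕ) (τ : Equiv.Perm (Fin n₂)) : Equiv.Perm (Fin (n₁ + n₂)) :=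
  finSumFinEquiv.permCongr (Equiv.sumCongr (Equiv.refl _) τ)

lemma permSecondBlock_castAdd (τ : Equiv.Perm (Fin n₂)) (i : Fin n₁) :
    permSecondBlock n₁ τ (Fin.castAdd n₂ i) = Fin.castAdd n₂ i := by
  simp [permSecondBlock, Equiv.permCongr_apply]

lemma permSecondBlock_natAdd (τ : Equiv.Perm (Fin n₂)) (k : Fin n₂) :
    permSecondBlock n₁ τ (Fin.natAdd n₁ k) = Fin.natAdd n₁ (τ k) := by
  simp [permSecondBlock, Equiv.permCongr_apply]

/-- The map of the pooled indices that exchanges the `i`-th elements of the two blocks for every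
`i` with `ε i = -1`. -/
def swapBlocks (hn : n₁ ≤ n₂) (ε : Fin n₁ → ℤˣ) : Fin (n₁ + n₂) → Fin (n₁ + n₂) :=
  Fin.addCases
    (fun i => if ε i = 1 then Fin.castAdd n₂ i else Fin.natAdd n₁ (Fin.castLE hn i))
    (fun k => if h : k.val < n₁ then
      if ε ⟨k.val, h⟩ = 1 then Fin.natAdd n₁ k else Fin.castAdd n₂ ⟨k.val, h⟩
      else Fin.natAdd n₁ k)

lemma swapBlocks_castAdd (hn : n₁ ≤ n₂) (ε : Fin n₁ → ℤˣ) (i : Fin n₁) :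
    swapBlocks hn ε (Fin.castAdd n₂ i)
      = if ε i = 1 then Fin.castAdd n₂ i else Fin.natAdd n₁ (Fin.castLE hn i) := by
  simp [swapBlocks]

lemma swapBlocks_natAdd (hn : n₁ ≤ n₂) (ε : Fin n₁ → ℤˣ) (i : Fin n₁) :
    swapBlocks hn ε (Fin.natAdd n₁ (Fin.castLE hn i))
      = if ε i = 1 then Fin.natAdd n₁ (Fin.castLE hn i) else Fin.castAdd n₂ i := by
  simp [swapBlocks]
  rfl

/-- Being an involution makes the exchange a permutation, so composing with it on the right
preserves the uniform law. -/
lemma swapBlocks_involutive (hn : n₁ ≤ n₂) (ε : Fin n₁ → ℤˣ) :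
    Function.Involutive (swapBlocks hn ε) := by
  intro x
  refine Fin.addCases (fun i => ?_) (fun k => ?_) x
  · rw [swapBlocks_castAdd]
    split_ifs with h
    · rw [swapBlocks_castAdd, if_pos h]
    · rw [swapBlocks_natAdd, if_neg h]
  · by_cases hk : k.val < n₁
    · obtain ⟨i, rfl⟩ : ∃ i : Fin n₁, Fin.castLE hn i = k := ⟨⟨k.val, hk⟩, rfl⟩
      rw [swapBlocks_natAdd]
      split_ifs with h
      · rw [swapBlocks_natAdd, if_pos h]
      · rw [swapBlocks_castAdd, if_neg h]
    · simp [swapBlocks, hk]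

/-- Exponential moments of the permuted statistic under a uniformly random permutation are
bounded by those of a paired statistic with random signs. -/
lemma sum_exp_permutedUStat_le (hn : n₁ ≤ n₂) (hn₂ : 2 ≤ n₂)
    (D : Fin (n₁ + n₂) → EuclideanSpace ℝ (Fin d)) (l : ℝ) :
    Fintype.card (Fin n₁ → ℤˣ) *
      ∑ ρ : Equiv.Perm (Fin (n₁ + n₂)), Real.exp (l * permutedUStat D ρ)
      ≤ ∑ ρ : Equiv.Perm (Fin (n₁ + n₂)), ∑ ε : Fin n₁ → ℤˣ,
        Real.exp (l / ((n₁ : ℝ) * ((n₁ : ℝ) - 1)) * offDiagForm fun i => signVal (ε i) •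
          (D (ρ (Fin.castAdd n₂ i)) - D (ρ (Fin.natAdd n₁ (Fin.castLE hn i))))) := by
  set G : Equiv.Perm (Fin (n₁ + n₂)) → ℝ := fun ρ =>
    Real.exp (l / ((n₁ : ℝ) * ((n₁ : ℝ) - 1)) * offDiagForm fun i =>
      (D (ρ (Fin.castAdd n₂ i)) - D (ρ (Fin.natAdd n₁ (Fin.castLE hn i))))) with hG
  have hc : (0 : ℝ) < (Fintype.card (Equiv.Perm (Fin n₂)) : ℕ) := by
    exact_mod_cast Fintype.card_pos
  -- Jensen over the matchings `τ`; each `τ` acts as a permutation of the pooled indices and is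
  -- absorbed into `ρ` once `ρ` is summed.
  have h1 : ∀ ρ : Equiv.Perm (Fin (n₁ + n₂)), Real.exp (l * permutedUStat D ρ)
      ≤ (∑ τ : Equiv.Perm (Fin n₂), G (ρ * permSecondBlock n₁ τ))
        / Fintype.card (Equiv.Perm (Fin n₂)) := by
    intro ρ
    have h := exp_average_le (Finset.univ : Finset (Equiv.Perm (Fin n₂))) Finset.univ_nonempty
      fun τ => l * (1 / ((n₁ : ℝ) * ((n₁ : ℝ) - 1)) * offDiagForm fun i =>
      (D (ρ (Fin.castAdd n₂ i)) - D (ρ (Fin.natAdd n₁ (τ (Fin.castLE hn i))))))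
    rw [← Finset.mul_sum, mul_div_assoc,
      ← uStat_eq_average_pairing hn hn₂ (fun i => D (ρ (Fin.castAdd n₂ i)))
        (fun k => D (ρ (Fin.natAdd n₁ k)))] at h
    refine h.trans_eq ?_
    rw [Finset.card_univ]
    congr 1
    refine Finset.sum_congr rfl fun τ _ => ?_
    simp only [hG, Equiv.Perm.mul_apply, permSecondBlock_castAdd, permSecondBlock_natAdd]
    congr 1
    ring
  have h2 : ∑ ρ : Equiv.Perm (Fin (n₁ + n₂)), Real.exp (l * permutedUStat D ρ) ≤ ∑ ρ, G ρ := by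
    refine (Finset.sum_le_sum fun ρ _ => h1 ρ).trans_eq ?_
    rw [← Finset.sum_div, Finset.sum_comm]
    have : ∀ τ : Equiv.Perm (Fin n₂), ∑ ρ, G (ρ * permSecondBlock n₁ τ) = ∑ ρ, G ρ :=
      fun τ => Equiv.sum_comp (Equiv.mulRight (permSecondBlock n₁ τ)) G
    simp only [this, Finset.sum_const, Finset.card_univ, nsmul_eq_mul]
    rw [mul_div_cancel_left₀ _ hc.ne']
  -- Exchanging the members of a pair negates its difference, so for fixed `ε` the substitution `ρ ↦
  -- ρ * swap` removes all signs.
  have h3 : ∀ ε : Fin n₁ → ℤˣ, ∑ ρ : Equiv.Perm (Fin (n₁ + n₂)),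
        Real.exp (l / ((n₁ : ℝ) * ((n₁ : ℝ) - 1)) * offDiagForm fun i => signVal (ε i) •
          (D (ρ (Fin.castAdd n₂ i)) - D (ρ (Fin.natAdd n₁ (Fin.castLE hn i))))) = ∑ ρ, G ρ := by
    intro ε
    rw [← Equiv.sum_comp (Equiv.mulRight (swapBlocks_involutive hn ε).toPerm) G]
    refine Finset.sum_congr rfl fun ρ _ => ?_
    simp only [hG, Equiv.coe_mulRight, Equiv.Perm.mul_apply, Function.Involutive.coe_toPerm,
      swapBlocks_castAdd, swapBlocks_natAdd]
    congr 3
    funext i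
    rcases Int.units_eq_one_or (ε i) with h | h <;> simp [h]
  rw [Finset.sum_comm]
  simp only [h3, Finset.sum_const, Finset.card_univ, nsmul_eq_mul]
  gcongr

end Permutations

/-! ### Forms whose means are multiples of one vector -/

section CollinearMeans

variable {κ F : Type*} [Fintype κ] [NormedAddCommGroup F] [InnerProductSpace ℝ F]

/-- The diagonal enters with a negative sign and is dropped; what remains depends on the weights
only through their sum. -/
lemma offDiagForm_smul_le [DecidableEq κ] (w : κ → ℝ) (δ : F) :
    offDiagForm (fun k => w k • δ) ≤ (∑ k, w k) ^ 2 * ‖δ‖ ^ 2 := by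
  rw [offDiagForm_eq_norm_sq_sub, ← Finset.sum_smul, norm_smul, mul_pow, Real.norm_eq_abs, sq_abs]
  have : 0 ≤ ∑ k, ‖w k • δ‖ ^ 2 := Finset.sum_nonneg fun k _ => sq_nonneg _
  linarith

lemma sum_norm_sq_sum_sub_smul_le {w : κ → ℝ} (hw : ∀ k, |w k| ≤ 1) (δ : F) :
    ∑ k, ‖∑ j, w j • δ - w k • δ‖ ^ 2
      ≤ Fintype.card κ * (2 * ((∑ k, w k) ^ 2 * ‖δ‖ ^ 2) + 2 * ‖δ‖ ^ 2) := by
  have : ∀ k ∈ Finset.univ, ‖∑ j, w j • δ - w k • δ‖ ^ 2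
      ≤ 2 * ((∑ k, w k) ^ 2 * ‖δ‖ ^ 2) + 2 * ‖δ‖ ^ 2 := by
    intro k _
    rw [← Finset.sum_smul, ← sub_smul, norm_smul, mul_pow, Real.norm_eq_abs, sq_abs]
    have h1 : w k ^ 2 ≤ 1 := (sq_le_one_iff_abs_le_one _).2 (hw k)
    have h2 : (∑ j, w j - w k) ^ 2 ≤ 2 * (∑ j, w j) ^ 2 + 2 := by
      nlinarith [sq_nonneg (∑ j, w j + w k)]
    nlinarith [mul_le_mul_of_nonneg_right h2 (sq_nonneg ‖δ‖)]
  refine (Finset.sum_le_sum this).trans_eq ?_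
  rw [Finset.sum_const, Finset.card_univ, nsmul_eq_mul]

end CollinearMeans

/-! ### Matched differences, with constant and with signed means -/

section Pairing

variable {Ω : Type*} [MeasurableSpace Ω] {P : Measure Ω} {ι κ κ' : Type*} [Fintype ι] [Fintype κ]

/-- Signed differences of disjoint pairs from an independent sub-Gaussian family. -/
lemma splitSubGaussian_signed_sub {ξ : κ' → Ω → EuclideanSpace ℝ ι} {s : ℝ}
    (hξm : ∀ m, Measurable (ξ m)) (hξi : iIndepFun ξ P)
    (hξ : ∀ m, ExpMomentSubGaussian P (ξ m) s) {p q : κ → κ'}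
    (hpq : Function.Injective (Sum.elim p q)) (ε : κ → ℤˣ) :
    SplitSubGaussian P (fun k ω => signVal (ε k) • (ξ (p k) ω - ξ (q k) ω)) (2 * s) where
  measurable k := by fun_prop
  expMoment_linear_le c := by
    set C : κ ⊕ κ → EuclideanSpace ℝ ι :=
      Sum.elim (fun k => signVal (ε k) • c k) (fun k => -(signVal (ε k) • c k)) with hC
    have hi : iIndepFun (fun x ω => (inner ℝ (C x) (ξ (Sum.elim p q x) ω) : ℝ)) P :=
      (hξi.precomp hpq).comp (fun x y => inner ℝ (C x) y) fun x => by fun_prop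
    have h1 : (fun ω => ∑ k, inner ℝ (c k) (signVal (ε k) • (ξ (p k) ω - ξ (q k) ω)))
        = fun ω => ∑ x, inner ℝ (C x) (ξ (Sum.elim p q x) ω) := by
      funext ω
      rw [Fintype.sum_sum_type, ← Finset.sum_add_distrib]
      refine Finset.sum_congr rfl fun k _ => ?_
      simp only [hC, Sum.elim_inl, Sum.elim_inr, inner_neg_left, real_inner_smul_left,
        real_inner_smul_right, inner_sub_right]
      ring
    rw [h1, expMoment_sum_of_iIndepFun Finset.univ hi fun x => (hξm _).const_inner]
    refine (Finset.prod_le_prod' fun x _ => hξ (Sum.elim p q x) (C x)).trans_eq ?_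
    rw [← ENNReal.ofReal_prod_of_nonneg fun _ _ => (Real.exp_pos _).le, ← Real.exp_sum,
      Fintype.sum_sum_type]
    simp only [hC, Sum.elim_inl, Sum.elim_inr, norm_neg, norm_smul, Real.norm_eq_abs, abs_signVal,
      one_mul, ← Finset.mul_sum, ← Finset.sum_div]
    congr 2
    ring
  indepFun S T hST := by
    classical
    have hdisj : Disjoint (S.disjSum S) (T.disjSum T) := by
      rw [Finset.disjoint_left] at hST ⊢
      rintro (x | x) hx hx' <;> simp at hx hx' <;> exact hST hx hx'
    have h := (hξi.precomp hpq).indepFun_finset _ _ hdisj fun x => hξm _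
    -- Each partial sum is a measurable function of the vectors indexed by two copies of `S`, one
    -- for each side of the pairs; these index sets are disjoint for disjoint `S` and `T`.
    let φ (S : Finset κ) (f : ↥(S.disjSum S) → EuclideanSpace ℝ ι) : EuclideanSpace ℝ ι :=
      ∑ k ∈ S.attach, signVal (ε k) •
        (f ⟨Sum.inl k, Finset.inl_mem_disjSum.2 k.2⟩ - f ⟨Sum.inr k, Finset.inr_mem_disjSum.2 k.2⟩)
    have hφ : ∀ S, Measurable (φ S) := fun S => by
      refine Finset.measurable_sum _ fun k _ => ?_
      fun_prop
    convert h.comp (hφ S) (hφ T) using 1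
    all_goals
      funext ω
      simp only [φ, Function.comp_apply, Sum.elim_inl, Sum.elim_inr]
      exact (Finset.sum_attach _ fun k => signVal (ε k) • (ξ (p k) ω - ξ (q k) ω)).symm

variable [DecidableEq κ]

/-- Exponential moments of an off-diagonal form with common mean `δ`. -/
lemma SplitSubGaussian.expMoment_offDiagForm_const_add_le [IsProbabilityMeasure P]
    {η : κ → Ω → EuclideanSpace ℝ ι} {s : ℝ} (h : SplitSubGaussian P η s) (hs : 0 ≤ s)
    (δ : EuclideanSpace ℝ ι) {l : ℝ}
    (hl : 32 * (l ^ 2 * s ^ 2 * (Fintype.card κ : ℝ) ^ 2) ≤ 1) :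
    expMoment P (fun ω => l * offDiagForm fun k => δ + η k ω)
      ≤ ENNReal.ofReal (Real.exp
        (l * ((Fintype.card κ : ℝ) * ((Fintype.card κ : ℝ) - 1) * ‖δ‖ ^ 2)
        + (8 * (l ^ 2 * s) * (Fintype.card κ * (((Fintype.card κ : ℝ) - 1) ^ 2 * ‖δ‖ ^ 2))
        + 16 * (l ^ 2 * s ^ 2 * (Fintype.card κ : ℝ) ^ 2) * Fintype.card ι))) := by
  refine (h.expMoment_offDiagForm_add_le hs (fun _ => δ) hl).trans_eq ?_
  have h0 : ∑ _j : κ, δ = (Fintype.card κ : ℝ) • δ := by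
    rw [Finset.sum_const, Finset.card_univ, Nat.cast_smul_eq_nsmul]
  have h1 : ‖∑ _j : κ, δ - δ‖ ^ 2 = ((Fintype.card κ : ℝ) - 1) ^ 2 * ‖δ‖ ^ 2 := by
    have : ∑ _j : κ, δ - δ = ((Fintype.card κ : ℝ) - 1) • δ := by rw [h0, sub_smul, one_smul]
    rw [this, norm_smul, mul_pow, Real.norm_eq_abs, sq_abs]
  rw [offDiagForm_eq_norm_sq_sub, h1, h0, norm_smul, mul_pow, Real.norm_eq_abs, sq_abs]
  simp only [Finset.sum_const, Finset.card_univ, nsmul_eq_mul]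
  congr 2
  ring

/-- Exponential moments of an off-diagonal form with randomly signed means proportional to a
vector `δ`, summed over all signs. -/
lemma sum_expMoment_signed_offDiagForm_le [IsProbabilityMeasure P]
    {η : κ → Ω → EuclideanSpace ℝ ι} {s : ℝ}
    (h : ∀ ε : κ → ℤˣ, SplitSubGaussian P (fun k ω => signVal (ε k) • η k ω) s) (hs : 0 ≤ s)
    (δ : EuclideanSpace ℝ ι) {r : κ → ℝ} (hr : ∀ k, |r k| ≤ 1) {l : ℝ} (hl0 : 0 ≤ l)
    (hl : 32 * (l ^ 2 * s ^ 2 * (Fintype.card κ : ℝ) ^ 2) ≤ 1)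
    (ha : (l * ‖δ‖ ^ 2 + 16 * (l ^ 2 * s) * (Fintype.card κ * ‖δ‖ ^ 2)) * Fintype.card κ ≤ 1 / 4) :
    ∑ ε : κ → ℤˣ, expMoment P (fun ω => l * offDiagForm fun k =>
        signVal (ε k) • (r k • δ + η k ω))
      ≤ Fintype.card (κ → ℤˣ) * ENNReal.ofReal (Real.exp (1 / 2
        + (16 * (l ^ 2 * s) * (Fintype.card κ * ‖δ‖ ^ 2)
        + 16 * (l ^ 2 * s ^ 2 * (Fintype.card κ : ℝ) ^ 2) * Fintype.card ι))) := by
  set n : ℝ := ((Fintype.card κ : ℕ) : ℝ) with hn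
  set a := l * ‖δ‖ ^ 2 + 16 * (l ^ 2 * s) * (n * ‖δ‖ ^ 2) with ha'
  set K := 16 * (l ^ 2 * s) * (n * ‖δ‖ ^ 2) + 16 * (l ^ 2 * s ^ 2 * n ^ 2) * Fintype.card ι
    with hK
  have hn0 : 0 ≤ n := Nat.cast_nonneg _
  have hterm : ∀ ε : κ → ℤˣ, expMoment P (fun ω => l * offDiagForm fun k =>
        signVal (ε k) • (r k • δ + η k ω))
      ≤ ENNReal.ofReal (Real.exp K) *
        ENNReal.ofReal (Real.exp (a * (∑ k, signVal (ε k) * r k) ^ 2)) := by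
    intro ε
    set R := ∑ k, signVal (ε k) * r k with hR
    have h1 := (h ε).expMoment_offDiagForm_add_le hs (fun k => (signVal (ε k) * r k) • δ) hl
    simp only [smul_add, smul_smul]
    refine h1.trans ?_
    rw [← ENNReal.ofReal_mul (Real.exp_pos _).le, ← Real.exp_add]
    refine ENNReal.ofReal_le_ofReal (Real.exp_le_exp.2 ?_)
    have hw : ∀ k, |signVal (ε k) * r k| ≤ 1 := fun k => by
      rw [abs_mul, abs_signVal, one_mul]
      exact hr k
    have hQ := offDiagForm_smul_le (fun k => signVal (ε k) * r k) δ
    have hc := sum_norm_sq_sum_sub_smul_le hw δ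
    rw [← hR] at hQ hc
    rw [← hn] at hc
    have h4 := mul_le_mul_of_nonneg_left hQ hl0
    have h5 := mul_le_mul_of_nonneg_left hc (show 0 ≤ 8 * (l ^ 2 * s) by positivity)
    simp only [ha', hK]
    linarith
  refine (Finset.sum_le_sum fun ε _ => hterm ε).trans ?_
  rw [← Finset.mul_sum]
  -- The hypothesis that `a` times the number of pairs is at most `1/4` is what bounds the sign
  -- average by `exp (1/2)`.
  have h6 := sum_exp_sq_signed_sum_le hr (c := a) (by positivity) ha
  refine (mul_le_mul_right h6 _).trans ?_
  rw [mul_left_comm, ← ENNReal.ofReal_mul (Real.exp_pos _).le, ← Real.exp_add]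
  exact mul_le_mul_right (ENNReal.ofReal_le_ofReal (Real.exp_le_exp.2 (by linarith))) _

end Pairing

/-! ### Exponential moments of the statistic and of its permuted version -/

section Tails

variable {Ω : Type*} [MeasurableSpace Ω] {P : Measure Ω} {d n₁ n₂ : ℕ}

lemma measurable_uStat {Z : Fin n₁ → Ω → EuclideanSpace ℝ (Fin d)}
    {W : Fin n₂ → Ω → EuclideanSpace ℝ (Fin d)} (hZ : ∀ i, Measurable (Z i))
    (hW : ∀ k, Measurable (W k)) :
    Measurable fun ω => uStat (fun i => Z i ω) (fun k => W k ω) := by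
  unfold uStat
  refine (Finset.measurable_sum _ fun p _ => Finset.measurable_sum _ fun q _ => ?_).const_mul _
  exact ((hZ _).sub (hW _)).inner ((hZ _).sub (hW _))

lemma measurable_permutedUStat {D : Fin (n₁ + n₂) → Ω → EuclideanSpace ℝ (Fin d)}
    (hD : ∀ m, Measurable (D m)) (ρ : Equiv.Perm (Fin (n₁ + n₂))) :
    Measurable fun ω => permutedUStat (fun m => D m ω) ρ :=
  measurable_uStat (fun _ => hD _) (fun _ => hD _)

lemma measurable_offDiagForm {κ ι : Type*} [Fintype κ] [DecidableEq κ] [Fintype ι]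
    {V : κ → Ω → EuclideanSpace ℝ ι} (hV : ∀ k, Measurable (V k)) :
    Measurable fun ω => offDiagForm fun k => V k ω := by
  unfold offDiagForm
  exact Finset.measurable_sum _ fun p _ => (hV _).inner (hV _)

variable {D : Fin (n₁ + n₂) → Ω → EuclideanSpace ℝ (Fin d)} {a b : EuclideanSpace ℝ (Fin d)}
  {s : ℝ}

/-- This says that the matched pairs are disjoint, as independence of their differences requires. -/
lemma injective_elim_castAdd_natAdd (hn : n₁ ≤ n₂) (τ : Equiv.Perm (Fin n₂)) :
    Function.Injective (Sum.elim (fun i : Fin n₁ => Fin.castAdd n₂ i)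
      fun i : Fin n₁ => Fin.natAdd n₁ (τ (Fin.castLE hn i))) := by
  refine (Fin.castAdd_injective n₁ n₂).sumElim
    ((Fin.natAdd_injective n₂ n₁).comp (τ.injective.comp (Fin.castLE_injective hn))) ?_
  intro i j h
  have := congrArg Fin.val h
  simp at this
  omega

/-- Exponential moments of the two-sample statistic at a negative parameter. -/
lemma expMoment_neg_uStat_le [IsProbabilityMeasure P] (hn : n₁ ≤ n₂) (hn₂ : 2 ≤ n₂)
    (hDm : ∀ m, Measurable (D m)) (hDi : iIndepFun D P) (hs : 0 ≤ s)
    (hD : ∀ m, ExpMomentSubGaussian P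
      (fun ω => D m ω - Fin.append (fun _ : Fin n₁ => a) (fun _ : Fin n₂ => b) m) s)
    {t l : ℝ} (hlt : l = t / ((n₁ : ℝ) * ((n₁ : ℝ) - 1)))
    (hl : 32 * (l ^ 2 * (2 * s) ^ 2 * (n₁ : ℝ) ^ 2) ≤ 1) :
    expMoment P (fun ω => -t * uStat (fun i : Fin n₁ => D (Fin.castAdd n₂ i) ω)
        (fun k : Fin n₂ => D (Fin.natAdd n₁ k) ω))
      ≤ ENNReal.ofReal (Real.exp (-l * ((n₁ : ℝ) * ((n₁ : ℝ) - 1) * ‖a - b‖ ^ 2)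
        + (8 * (l ^ 2 * (2 * s)) * (n₁ * (((n₁ : ℝ) - 1) ^ 2 * ‖a - b‖ ^ 2))
        + 16 * (l ^ 2 * (2 * s) ^ 2 * (n₁ : ℝ) ^ 2) * d))) := by
  have hξm : ∀ m, Measurable fun ω =>
      D m ω - Fin.append (fun _ : Fin n₁ => a) (fun _ : Fin n₂ => b) m :=
    fun m => (hDm m).sub_const _
  have hξi : iIndepFun (fun m ω => D m ω -
      Fin.append (fun _ : Fin n₁ => a) (fun _ : Fin n₂ => b) m) P :=
    hDi.comp (fun m x => x - Fin.append (fun _ : Fin n₁ => a) (fun _ : Fin n₂ => b) m)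
      fun m => measurable_id.sub_const _
  have h0 : (fun ω => -t * uStat (fun i : Fin n₁ => D (Fin.castAdd n₂ i) ω)
        (fun k : Fin n₂ => D (Fin.natAdd n₁ k) ω))
      = fun ω => (∑ τ : Equiv.Perm (Fin n₂), -l * offDiagForm fun i : Fin n₁ =>
        D (Fin.castAdd n₂ i) ω - D (Fin.natAdd n₁ (τ (Fin.castLE hn i))) ω)
        / (Finset.univ : Finset (Equiv.Perm (Fin n₂))).card := by
    funext ω
    rw [uStat_eq_average_pairing hn hn₂, ← Finset.mul_sum, ← Finset.mul_sum, hlt]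
    ring
  rw [h0]
  refine expMoment_average_le _ Finset.univ_nonempty _ (fun τ _ =>
    (measurable_offDiagForm fun i => (hDm _).sub (hDm _)).const_mul _) _ fun τ _ => ?_
  have h1 := (splitSubGaussian_signed_sub hξm hξi hD (injective_elim_castAdd_natAdd hn τ)
    1).expMoment_offDiagForm_const_add_le (by positivity) (a - b) (l := -l) (by simpa using hl)
  simp only [Fintype.card_fin, neg_sq] at h1
  refine (le_of_eq ?_).trans h1
  congr 1
  funext ω
  congr 2
  funext i
  simp
  abel

/-- Exponential moments of the permuted statistic, averaged over all permutations. -/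
lemma sum_expMoment_permutedUStat_le [IsProbabilityMeasure P] (hn : n₁ ≤ n₂) (hn₂ : 2 ≤ n₂)
    (hDm : ∀ m, Measurable (D m)) (hDi : iIndepFun D P) (hs : 0 ≤ s)
    (hD : ∀ m, ExpMomentSubGaussian P
      (fun ω => D m ω - Fin.append (fun _ : Fin n₁ => a) (fun _ : Fin n₂ => b) m) s)
    {t l : ℝ} (hlt : l = t / ((n₁ : ℝ) * ((n₁ : ℝ) - 1))) (hl0 : 0 ≤ l)
    (hl : 32 * (l ^ 2 * (2 * s) ^ 2 * (n₁ : ℝ) ^ 2) ≤ 1)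
    (hla : (l * ‖a - b‖ ^ 2 + 16 * (l ^ 2 * (2 * s)) * (n₁ * ‖a - b‖ ^ 2)) * n₁ ≤ 1 / 4) :
    ∑ ρ : Equiv.Perm (Fin (n₁ + n₂)), expMoment P (fun ω => t * permutedUStat (fun m => D m ω) ρ)
      ≤ Fintype.card (Equiv.Perm (Fin (n₁ + n₂))) * ENNReal.ofReal (Real.exp (1 / 2
        + (16 * (l ^ 2 * (2 * s)) * (n₁ * ‖a - b‖ ^ 2)
        + 16 * (l ^ 2 * (2 * s) ^ 2 * (n₁ : ℝ) ^ 2) * d))) := by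
  set M : Fin (n₁ + n₂) → EuclideanSpace ℝ (Fin d) :=
    Fin.append (fun _ : Fin n₁ => a) (fun _ : Fin n₂ => b) with hM
  set K := ENNReal.ofReal (Real.exp (1 / 2 + (16 * (l ^ 2 * (2 * s)) * (n₁ * ‖a - b‖ ^ 2)
        + 16 * (l ^ 2 * (2 * s) ^ 2 * (n₁ : ℝ) ^ 2) * d))) with hK
  have hξm : ∀ m, Measurable fun ω => D m ω - M m := fun m => (hDm m).sub_const _
  have hξi : iIndepFun (fun m ω => D m ω - M m) P :=
    hDi.comp (fun m x => x - M m) fun m => measurable_id.sub_const _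
  have hsign : ∀ ρ : Equiv.Perm (Fin (n₁ + n₂)),
      ∑ ε : Fin n₁ → ℤˣ, expMoment P (fun ω => l * offDiagForm fun i => signVal (ε i) •
        (D (ρ (Fin.castAdd n₂ i)) ω - D (ρ (Fin.natAdd n₁ (Fin.castLE hn i))) ω))
      ≤ Fintype.card (Fin n₁ → ℤˣ) * K := by
    intro ρ
    -- Each permuted entry has mean `a` or `b`, so `r` is `0`, `1` or `-1`.
    have hr : ∀ i : Fin n₁, ∃ r : ℝ, |r| ≤ 1 ∧ M (ρ (Fin.castAdd n₂ i))
        - M (ρ (Fin.natAdd n₁ (Fin.castLE hn i))) = r • (a - b) := by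
      intro i
      have hMv : ∀ m, M m = a ∨ M m = b := by
        intro m
        refine Fin.addCases (fun i => ?_) (fun k => ?_) m
        · left; simp [hM]
        · right; simp [hM]
      rcases hMv (ρ (Fin.castAdd n₂ i)) with h | h <;>
        rcases hMv (ρ (Fin.natAdd n₁ (Fin.castLE hn i))) with h' | h' <;> rw [h, h']
      · exact ⟨0, by simp, by simp⟩
      · exact ⟨1, by simp, by simp⟩
      · exact ⟨-1, by simp, by simp⟩
      · exact ⟨0, by simp, by simp⟩
    choose r hr1 hr2 using hr
    have hinj : Function.Injective (Sum.elim (fun i : Fin n₁ => ρ (Fin.castAdd n₂ i))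
        fun i : Fin n₁ => ρ (Fin.natAdd n₁ (Fin.castLE hn i))) := by
      have := ρ.injective.comp (injective_elim_castAdd_natAdd hn 1)
      rwa [Sum.comp_elim] at this
    have h1 := sum_expMoment_signed_offDiagForm_le
      (η := fun i ω => (D (ρ (Fin.castAdd n₂ i)) ω - M (ρ (Fin.castAdd n₂ i)))
        - (D (ρ (Fin.natAdd n₁ (Fin.castLE hn i))) ω - M (ρ (Fin.natAdd n₁ (Fin.castLE hn i)))))
      (fun ε => splitSubGaussian_signed_sub hξm hξi hD hinj ε) (by positivity) (a - b) hr1 hl0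
      (by simpa using hl) (by simpa using hla)
    simp only [Fintype.card_fin] at h1
    refine (le_of_eq ?_).trans h1
    refine Finset.sum_congr rfl fun ε _ => ?_
    congr 1
    funext ω
    congr 2
    funext i
    rw [← hr2]
    congr 1
    abel
  have hc : (Fintype.card (Fin n₁ → ℤˣ) : ENNReal) ≠ 0 := by
    exact_mod_cast Fintype.card_ne_zero
  refine (ENNReal.mul_le_mul_iff_right hc (by simp)).1 ?_
  calc (Fintype.card (Fin n₁ → ℤˣ) : ENNReal) * ∑ ρ : Equiv.Perm (Fin (n₁ + n₂)),
        expMoment P (fun ω => t * permutedUStat (fun m => D m ω) ρ)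
      = ∫⁻ ω, Fintype.card (Fin n₁ → ℤˣ) * ∑ ρ : Equiv.Perm (Fin (n₁ + n₂)),
          ENNReal.ofReal (Real.exp (t * permutedUStat (fun m => D m ω) ρ)) ∂P := by
        rw [lintegral_const_mul' _ _ (by simp), lintegral_finsetSum _ fun ρ _ =>
          measurable_ofReal_exp ((measurable_permutedUStat hDm ρ).const_mul _)]
        rfl
    _ ≤ ∫⁻ ω, ∑ ρ : Equiv.Perm (Fin (n₁ + n₂)), ∑ ε : Fin n₁ → ℤˣ,
          ENNReal.ofReal (Real.exp (l * offDiagForm fun i => signVal (ε i) •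
          (D (ρ (Fin.castAdd n₂ i)) ω - D (ρ (Fin.natAdd n₁ (Fin.castLE hn i))) ω))) ∂P := by
        refine lintegral_mono fun ω => ?_
        have h := sum_exp_permutedUStat_le hn hn₂ (fun m => D m ω) t
        rw [← hlt] at h
        have h' := ENNReal.ofReal_le_ofReal h
        rw [ENNReal.ofReal_mul (by positivity), ENNReal.ofReal_natCast,
          ENNReal.ofReal_sum_of_nonneg fun _ _ => (Real.exp_pos _).le,
          ENNReal.ofReal_sum_of_nonneg fun _ _ =>
            Finset.sum_nonneg fun _ _ => (Real.exp_pos _).le] at h'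
        refine h'.trans_eq (Finset.sum_congr rfl fun ρ _ => ?_)
        rw [ENNReal.ofReal_sum_of_nonneg fun _ _ => (Real.exp_pos _).le]
    _ = ∑ ρ : Equiv.Perm (Fin (n₁ + n₂)), ∑ ε : Fin n₁ → ℤˣ,
          expMoment P (fun ω => l * offDiagForm fun i => signVal (ε i) •
          (D (ρ (Fin.castAdd n₂ i)) ω - D (ρ (Fin.natAdd n₁ (Fin.castLE hn i))) ω)) := by
        have hme : ∀ (ρ : Equiv.Perm (Fin (n₁ + n₂))) (ε : Fin n₁ → ℤˣ), Measurable fun ω =>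
            ENNReal.ofReal (Real.exp (l * offDiagForm fun i => signVal (ε i) •
          (D (ρ (Fin.castAdd n₂ i)) ω - D (ρ (Fin.natAdd n₁ (Fin.castLE hn i))) ω))) :=
          fun ρ ε => measurable_ofReal_exp ((measurable_offDiagForm fun i => by fun_prop).const_mul _)
        rw [lintegral_finsetSum _ fun ρ _ => Finset.measurable_sum _ fun ε _ => hme ρ ε]
        refine Finset.sum_congr rfl fun ρ _ => ?_
        rw [lintegral_finsetSum _ fun ε _ => hme ρ ε]
        rfl
    _ ≤ ∑ _ρ : Equiv.Perm (Fin (n₁ + n₂)), Fintype.card (Fin n₁ → ℤˣ) * K :=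
        Finset.sum_le_sum fun ρ _ => hsign ρ
    _ = _ := by
        rw [Finset.sum_const, Finset.card_univ, nsmul_eq_mul, mul_left_comm]

end Tails

/-! ### Choice of the exponential parameter -/

/-- The size conditions on the exponential parameter `l = (4L/Δ) / (n(n-1))` that follow from the
separation of the means and the lower bound on the sample size. -/
lemma parameter_bounds {d n v L Δ l : ℝ} (hd : 1 ≤ d) (hv : 0 < v) (hL : 2 ≤ L)
    (hΔ : 10000 * Real.sqrt d * v / n * L ^ 2 ≤ Δ) (hn : 10000 * L ≤ n)
    (hl : l = 4 * L / Δ / (n * (n - 1))) :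
    0 < Δ ∧ 0 ≤ l ∧ l * (n * (n - 1) * Δ) = 4 * L ∧
    32 * (l ^ 2 * (2 * v) ^ 2 * n ^ 2) ≤ 1 ∧
    (l * Δ + 16 * (l ^ 2 * (2 * v)) * (n * Δ)) * n ≤ 1 / 4 ∧
    1 / 2 + (16 * (l ^ 2 * (2 * v)) * (n * Δ) + 16 * (l ^ 2 * (2 * v) ^ 2 * n ^ 2) * d) ≤ 1 ∧
    8 * (l ^ 2 * (2 * v)) * (n * ((n - 1) ^ 2 * Δ)) + 16 * (l ^ 2 * (2 * v) ^ 2 * n ^ 2) * d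
      ≤ 1 := by
  have hn0 : 0 < n := by linarith
  have hn1 : 0 < n - 1 := by linarith
  have hsd : 1 ≤ Real.sqrt d := Real.one_le_sqrt.2 hd
  have hΔ0 : 0 < Δ := lt_of_lt_of_le (by positivity) hΔ
  have hl0 : 0 ≤ l := by rw [hl]; positivity
  have hid : l * (n * (n - 1) * Δ) = 4 * L := by
    rw [hl]
    field_simp
  -- In the scale-free quantities `w` (noise over signal) and `y` (of order `L`), the linear error
  -- is of order `y² w` and the chaos error of order `y² w² d`. With `y ≤ 8L` both are controlled by
  -- `√d w L² ≤ 1/10000`.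
  set w := v / (Δ * n) with hw
  set y := l * Δ * n ^ 2 with hy
  have hw0 : 0 < w := by positivity
  have hy0 : 0 ≤ y := by positivity
  have hy8 : y ≤ 8 * L := by
    have h1 : n ^ 2 ≤ 2 * (n * (n - 1)) := by nlinarith
    have h2 := mul_le_mul_of_nonneg_left h1 (show 0 ≤ l * Δ by positivity)
    rw [hy]
    linarith
  have hvw : v = w * (Δ * n) := by rw [hw]; field_simp
  have hly : l = y / (Δ * n ^ 2) := by rw [hy]; field_simp
  have hsep : 10000 * (Real.sqrt d * (w * L ^ 2)) ≤ 1 := by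
    have h1 : 10000 * Real.sqrt d * v / n * L ^ 2
        = 10000 * (Real.sqrt d * (w * L ^ 2)) * Δ := by
      rw [hvw]
      field_simp
    rw [h1] at hΔ
    exact le_of_mul_le_mul_right (by linarith) hΔ0
  have hwL0 : 0 ≤ w * L ^ 2 := by positivity
  have hwL : 10000 * (w * L ^ 2) ≤ 1 := by nlinarith
  have hy2 : y ^ 2 ≤ 64 * L ^ 2 := by nlinarith
  have hy2w : y ^ 2 * w ≤ 64 / 10000 := by
    nlinarith [mul_le_mul_of_nonneg_right hy2 hw0.le]
  have hsq : (Real.sqrt d * (w * L ^ 2)) ^ 2 ≤ 1 / 10000 ^ 2 := by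
    have h0 : 0 ≤ Real.sqrt d * (w * L ^ 2) := by positivity
    have h1 : Real.sqrt d * (w * L ^ 2) ≤ 1 / 10000 := by linarith
    calc _ ≤ (1 / 10000 : ℝ) ^ 2 := by gcongr
      _ = _ := by norm_num
  have hdw : y ^ 2 * w ^ 2 * d ≤ 16 / 10000 ^ 2 := by
    have h1 : (Real.sqrt d * (w * L ^ 2)) ^ 2 = d * w ^ 2 * (L ^ 2 * L ^ 2) := by
      rw [mul_pow, Real.sq_sqrt (by linarith)]
      ring
    rw [h1] at hsq
    have h2 : 4 ≤ L ^ 2 := by nlinarith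
    have h3 : d * w ^ 2 * L ^ 2 * 4 ≤ d * w ^ 2 * L ^ 2 * L ^ 2 := by gcongr
    have h4 := mul_le_mul_of_nonneg_right hy2 (show 0 ≤ w ^ 2 * d by positivity)
    linarith
  have hq : l ^ 2 * (2 * v) ^ 2 * n ^ 2 = 4 * (y ^ 2 * w ^ 2) := by
    rw [hly, hvw]
    field_simp
    ring
  have hqd : y ^ 2 * w ^ 2 ≤ y ^ 2 * w ^ 2 * d := le_mul_of_one_le_right (by positivity) hd
  have hr : l ^ 2 * (2 * v) * (n * Δ) * n ^ 2 = 2 * (y ^ 2 * w) := by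
    rw [hly, hvw]
    field_simp
  have hn20000 : 20000 ≤ n := by linarith
  have hT0 : 0 ≤ l ^ 2 * (2 * v) * (n * Δ) := by positivity
  have hTn : l ^ 2 * (2 * v) * (n * Δ) * n ≤ 1 / 1000 := by
    have h1 : l ^ 2 * (2 * v) * (n * Δ) * n * 20000 ≤ l ^ 2 * (2 * v) * (n * Δ) * n * n := by
      gcongr
    nlinarith
  have hT : l ^ 2 * (2 * v) * (n * Δ) ≤ 1 / 1000 := by nlinarith
  have hq' : 16 * (l ^ 2 * (2 * v) ^ 2 * n ^ 2) * d = 64 * (y ^ 2 * w ^ 2 * d) := by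
    rw [hq]
    ring
  have hTn2 : l ^ 2 * (2 * v) * (n * Δ) * (n - 1) ^ 2 ≤ l ^ 2 * (2 * v) * (n * Δ) * n ^ 2 := by
    gcongr
    linarith
  -- The mean contribution to the permuted statistic: `y / n ≤ 8L / n`, small because `n ≥ 10000 L`.
  have hyn : l * Δ * n ≤ 8 / 10000 := by
    have : l * Δ * n * n = y := by rw [hy]; ring
    exact le_of_mul_le_mul_right (by linarith) hn0
  clear_value w y
  refine ⟨hΔ0, hl0, hid, ?_, ?_, ?_, ?_⟩
  · rw [hq]
    linarith
  · linarith
  · linarith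
  · linarith

/-! ### Chernoff bounds at half the mean -/

section Tails

variable {Ω : Type*} [MeasurableSpace Ω] {P : Measure Ω} {d n₁ n₂ : ℕ}
  {D : Fin (n₁ + n₂) → Ω → EuclideanSpace ℝ (Fin d)} {a b : EuclideanSpace ℝ (Fin d)} {s L : ℝ}

/-- The lower tail of the statistic and the averaged upper tail of the permuted statistic. -/
lemma measure_uStat_le_and_sum_measure_permutedUStat_ge [IsProbabilityMeasure P] (hd : 1 ≤ d)
    (hn : n₁ ≤ n₂) (hDm : ∀ m, Measurable (D m)) (hDi : iIndepFun D P) (hs : 0 < s)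
    (hD : ∀ m, ExpMomentSubGaussian P
      (fun ω => D m ω - Fin.append (fun _ : Fin n₁ => a) (fun _ : Fin n₂ => b) m) s)
    (hL : 2 ≤ L) (hsep : 10000 * Real.sqrt d * s / n₁ * L ^ 2 ≤ ‖a - b‖ ^ 2)
    (hnL : 10000 * L ≤ n₁) :
    P {ω | uStat (fun i : Fin n₁ => D (Fin.castAdd n₂ i) ω)
        (fun k : Fin n₂ => D (Fin.natAdd n₁ k) ω) ≤ ‖a - b‖ ^ 2 / 2}
        ≤ ENNReal.ofReal (Real.exp (1 - 2 * L)) ∧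
    ∑ ρ : Equiv.Perm (Fin (n₁ + n₂)),
        P {ω | ‖a - b‖ ^ 2 / 2 ≤ permutedUStat (fun m => D m ω) ρ}
        ≤ Fintype.card (Equiv.Perm (Fin (n₁ + n₂))) * ENNReal.ofReal (Real.exp (1 - 2 * L)) := by
  set Δ := ‖a - b‖ ^ 2 with hΔ
  set t := 4 * L / Δ with ht
  obtain ⟨hΔ0, hl0, hid, h1, h2, h3, h4⟩ := parameter_bounds (by exact_mod_cast hd) hs hL hsep hnL
    (rfl : t / ((n₁ : ℝ) * ((n₁ : ℝ) - 1)) = t / ((n₁ : ℝ) * ((n₁ : ℝ) - 1)))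
  set l := t / ((n₁ : ℝ) * ((n₁ : ℝ) - 1)) with hl
  have hn₂ : 2 ≤ n₂ := by
    have : (2 : ℝ) ≤ n₁ := by linarith
    exact le_trans (by exact_mod_cast this) hn
  have ht0 : 0 < t := by positivity
  -- The threshold `Δ/2` costs `2L` in the exponent. The lower tail gains `4L` from the mean and the
  -- upper tail gains nothing, so both end at `1 - 2L`, where `1` bounds the error terms.
  have htΔ : t * (Δ / 2) = 2 * L := by
    rw [ht]
    field_simp
    norm_num
  constructor
  · have hU := measurable_uStat (fun i : Fin n₁ => hDm (Fin.castAdd n₂ i))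
      (fun k : Fin n₂ => hDm (Fin.natAdd n₁ k))
    have h5 := measure_ge_le_expMoment (P := P) (hU.const_mul (-t)) (-t * (Δ / 2))
    have hset : {ω | uStat (fun i : Fin n₁ => D (Fin.castAdd n₂ i) ω)
        (fun k : Fin n₂ => D (Fin.natAdd n₁ k) ω) ≤ Δ / 2}
        = {ω | -t * (Δ / 2) ≤ -t * uStat (fun i : Fin n₁ => D (Fin.castAdd n₂ i) ω)
        (fun k : Fin n₂ => D (Fin.natAdd n₁ k) ω)} := by
      ext ω
      simp only [Set.mem_ofPred_eq, neg_mul, neg_le_neg_iff, mul_le_mul_iff_right₀ ht0]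
    rw [hset]
    refine h5.trans ((mul_le_mul_right
      (expMoment_neg_uStat_le hn hn₂ hDm hDi hs.le hD hl h1) _).trans ?_)
    rw [← ENNReal.ofReal_mul (Real.exp_pos _).le, ← Real.exp_add]
    refine ENNReal.ofReal_le_ofReal (Real.exp_le_exp.2 ?_)
    rw [← hΔ]
    linarith
  · have h5 : ∀ ρ : Equiv.Perm (Fin (n₁ + n₂)),
        P {ω | Δ / 2 ≤ permutedUStat (fun m => D m ω) ρ}
        ≤ ENNReal.ofReal (Real.exp (-(2 * L))) *
          expMoment P (fun ω => t * permutedUStat (fun m => D m ω) ρ) := by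
      intro ρ
      have h6 := measure_ge_le_expMoment (P := P)
        ((measurable_permutedUStat hDm ρ).const_mul t) (t * (Δ / 2))
      simp only [mul_le_mul_iff_right₀ ht0] at h6
      rwa [htΔ] at h6
    refine (Finset.sum_le_sum fun ρ _ => h5 ρ).trans ?_
    rw [← Finset.mul_sum]
    refine (mul_le_mul_right
      (sum_expMoment_permutedUStat_le hn hn₂ hDm hDi hs.le hD hl hl0 h1 h2) _).trans ?_
    rw [mul_left_comm, ← ENNReal.ofReal_mul (Real.exp_pos _).le, ← Real.exp_add]
    refine mul_le_mul_right (ENNReal.ofReal_le_ofReal (Real.exp_le_exp.2 ?_)) _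
    rw [← hΔ]
    linarith

end Tails

/-! ### Sub-Gaussian vectors and unbiasedness -/

section SubGaussianVector

variable {Ω : Type*} [MeasurableSpace Ω] {P : Measure Ω} {d : ℕ}

lemma IsSubGaussianVector.expMomentSubGaussian {X : Ω → EuclideanSpace ℝ (Fin d)} {s : ℝ≥0}
    (h : IsSubGaussianVector X s P) :
    ExpMomentSubGaussian P (fun ω => X ω - ∫ ω', X ω' ∂P) s := by
  intro v
  -- The parameter `1` suffices, since scaling is already contained in the choice of `v`.
  have h1 := (h v).integrable_exp_mul 1
  have h2 := (h v).mgf_le 1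
  simp only [mgf, one_mul] at h1 h2
  rw [expMoment, ← ofReal_integral_eq_lintegral_ofReal h1
    (Filter.Eventually.of_forall fun _ => (Real.exp_pos _).le)]
  refine ENNReal.ofReal_le_ofReal (h2.trans_eq ?_)
  push_cast
  congr 1
  simp
  ring

lemma IsSubGaussianVector.integrable [IsFiniteMeasure P] {X : Ω → EuclideanSpace ℝ (Fin d)}
    {s : ℝ≥0} (h : IsSubGaussianVector X s P) : Integrable X P := by
  -- The subtracted integral is a constant even if it were the default value `0` of a non-integrable
  -- function, so integrability of the difference gives that of `X` without circularity.
  have h1 : Integrable (fun ω => X ω - ∫ ω', X ω' ∂P) P := by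
    refine Integrable.of_eval_piLp fun i => ?_
    simpa [EuclideanSpace.inner_single_left] using (h (EuclideanSpace.single i 1)).integrable
  exact (h1.add (integrable_const (∫ ω', X ω' ∂P))).congr
    (Filter.Eventually.of_forall fun ω => by simp)

variable {n₁ n₂ : ℕ}

/-- The statistic is an unbiased estimator of the squared distance of the means. -/
lemma integral_uStat [IsProbabilityMeasure P] (hn₁ : 2 ≤ n₁) (hn₂ : 2 ≤ n₂)
    {D : Fin (n₁ + n₂) → Ω → EuclideanSpace ℝ (Fin d)} {a b : EuclideanSpace ℝ (Fin d)}
    (hDm : ∀ m, Measurable (D m))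
    (hDi : iIndepFun D P) (hDint : ∀ m, Integrable (D m) P)
    (ha : ∀ i : Fin n₁, ∫ ω, D (Fin.castAdd n₂ i) ω ∂P = a)
    (hb : ∀ k : Fin n₂, ∫ ω, D (Fin.natAdd n₁ k) ω ∂P = b) :
    ∫ ω, uStat (fun i : Fin n₁ => D (Fin.castAdd n₂ i) ω)
      (fun k : Fin n₂ => D (Fin.natAdd n₁ k) ω) ∂P = ‖a - b‖ ^ 2 := by
  have hpair : ∀ p ∈ (Finset.univ : Finset (Fin n₁)).offDiag,
      ∀ q ∈ (Finset.univ : Finset (Fin n₂)).offDiag,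
      IndepFun (fun ω => D (Fin.castAdd n₂ p.1) ω - D (Fin.natAdd n₁ q.1) ω)
        (fun ω => D (Fin.castAdd n₂ p.2) ω - D (Fin.natAdd n₁ q.2) ω) P := by
    intro p hp q hq
    have hp' := (Finset.mem_offDiag.1 hp).2.2
    have hq' := (Finset.mem_offDiag.1 hq).2.2
    refine (hDi.indepFun_prodMk_prodMk hDm (Fin.castAdd n₂ p.1) (Fin.natAdd n₁ q.1)
      (Fin.castAdd n₂ p.2) (Fin.natAdd n₁ q.2) ?_ ?_ ?_ ?_).comp
      (measurable_fst.sub measurable_snd) (measurable_fst.sub measurable_snd)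
    · exact (Fin.castAdd_injective n₁ n₂).ne hp'
    · intro h; have := congrArg Fin.val h; simp at this; omega
    · intro h; have := congrArg Fin.val h; simp at this; omega
    · exact (Fin.natAdd_injective n₂ n₁).ne hq'
  have hint : ∀ (i : Fin n₁) (k : Fin n₂), Integrable
      (fun ω => D (Fin.castAdd n₂ i) ω - D (Fin.natAdd n₁ k) ω) P :=
    fun i k => (hDint _).sub (hDint _)
  have hmean : ∀ (i : Fin n₁) (k : Fin n₂),
      ∫ ω, D (Fin.castAdd n₂ i) ω - D (Fin.natAdd n₁ k) ω ∂P = a - b := fun i k => by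
    rw [integral_sub (hDint _) (hDint _), ha, hb]
  have hinn : ∀ p ∈ (Finset.univ : Finset (Fin n₁)).offDiag,
      ∀ q ∈ (Finset.univ : Finset (Fin n₂)).offDiag,
      Integrable (fun ω => (inner ℝ (D (Fin.castAdd n₂ p.1) ω - D (Fin.natAdd n₁ q.1) ω)
        (D (Fin.castAdd n₂ p.2) ω - D (Fin.natAdd n₁ q.2) ω) : ℝ)) P :=
    fun p hp q hq => (hpair p hp q hq).integrable_bilin (hint _ _) (hint _ _) (innerSL ℝ)
  have hval : ∀ p ∈ (Finset.univ : Finset (Fin n₁)).offDiag,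
      ∀ q ∈ (Finset.univ : Finset (Fin n₂)).offDiag,
      ∫ ω, (inner ℝ (D (Fin.castAdd n₂ p.1) ω - D (Fin.natAdd n₁ q.1) ω)
        (D (Fin.castAdd n₂ p.2) ω - D (Fin.natAdd n₁ q.2) ω) : ℝ) ∂P = ‖a - b‖ ^ 2 := by
    intro p hp q hq
    have h := (hpair p hp q hq).integral_bilin (hint _ _) (hint _ _) (innerSL ℝ)
    rw [hmean, hmean] at h
    exact h.trans (real_inner_self_eq_norm_sq (a - b))
  have hcard : ∀ n : ℕ, ((Finset.univ : Finset (Fin n)).offDiag.card : ℝ)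
      = (n : ℝ) * ((n : ℝ) - 1) := by
    intro n
    rw [Finset.offDiag_card, Finset.card_univ, Fintype.card_fin, Nat.cast_sub (Nat.le_mul_self _)]
    push_cast
    ring
  unfold uStat
  rw [integral_const_mul, integral_finsetSum _ fun p hp =>
    integrable_finsetSum _ fun q hq => hinn p hp q hq,
    Finset.sum_congr rfl fun p hp => (integral_finsetSum _ fun q hq => hinn p hp q hq).trans
      (Finset.sum_congr rfl fun q hq => hval p hp q hq)]
  simp only [Finset.sum_const, nsmul_eq_mul, hcard]
  have h1 : (2 : ℝ) ≤ n₁ := by exact_mod_cast hn₁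
  have h2 : (2 : ℝ) ≤ n₂ := by exact_mod_cast hn₂
  have h3 : (n₁ : ℝ) - 1 ≠ 0 := by linarith
  have h4 : (n₂ : ℝ) - 1 ≠ 0 := by linarith
  field_simp

end SubGaussianVector

lemma append_apply_eq {Ω E : Type*} {n₁ n₂ : ℕ} (Z : Fin n₁ → Ω → E) (W : Fin n₂ → Ω → E) (ω : Ω) :
    Fin.append (fun i => Z i ω) (fun k => W k ω) = fun m => Fin.append Z W m ω := by
  funext m
  refine Fin.addCases (fun i => ?_) (fun k => ?_) m <;> simp

/-! ### Markov's inequality and conditioning on the permutation -/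

section PValue

variable {Ω : Type*} [MeasurableSpace Ω] {P : Measure Ω}

/-- Markov's inequality for the Monte Carlo permutation `p`-value. -/
lemma measureReal_permPValue_ge_le [IsProbabilityMeasure P] {B : ℕ} {T : Ω → ℝ}
    {Tperm : Fin B → Ω → ℝ} {F : Fin B → Set Ω} (hF : ∀ b, MeasurableSet (F b))
    (hTF : ∀ b ω, T ω ≤ Tperm b ω → ω ∈ F b) {q : ℝ} (hq : ∀ b, P.real (F b) ≤ q) {α : ℝ}
    (hα : 0 < α) :
    P.real {ω | α ≤ permPValue (T ω) (fun b => Tperm b ω)} ≤ (1 + B * q) / (α * (1 + B)) := by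
  have hB : (0 : ℝ) < 1 + B := by positivity
  have hint : ∀ b, Integrable ((F b).indicator fun _ => (1 : ℝ)) P :=
    fun b => (integrable_const 1).indicator (hF b)
  have hsumint : Integrable (fun ω => ∑ b, (F b).indicator (fun _ => (1 : ℝ)) ω) P :=
    integrable_finsetSum _ fun b _ => hint b
  have hnn : ∀ ω, 0 ≤ ∑ b, (F b).indicator (fun _ => (1 : ℝ)) ω :=
    fun ω => Finset.sum_nonneg fun b _ => Set.indicator_nonneg (fun _ _ => zero_le_one) ω
  -- The numerator of the `p`-value is dominated by a sum of indicators; only its expectation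
  -- enters, so the dependence between the events is irrelevant.
  have hM := mul_meas_ge_le_integral_of_nonneg (μ := P)
    (f := fun ω => 1 + ∑ b, (F b).indicator (fun _ => (1 : ℝ)) ω)
    (Filter.Eventually.of_forall fun ω => add_nonneg zero_le_one (hnn ω))
    ((integrable_const 1).add hsumint) (α * (1 + B))
  have hI : ∫ ω, 1 + ∑ b, (F b).indicator (fun _ => (1 : ℝ)) ω ∂P ≤ 1 + B * q := by
    rw [integral_add (integrable_const 1) hsumint, integral_finsetSum _ fun b _ => hint b]
    simp only [integral_const, probReal_univ, smul_eq_mul, one_mul]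
    have : ∑ b, ∫ ω, (F b).indicator (fun _ => (1 : ℝ)) ω ∂P ≤ ∑ _b : Fin B, q :=
      Finset.sum_le_sum fun b _ => (integral_indicator_one (hF b)).trans_le (hq b)
    simpa using this
  rw [le_div_iff₀ (by positivity), mul_comm]
  refine le_trans (mul_le_mul_of_nonneg_left (measureReal_mono fun ω hω => ?_) (by positivity))
    (hM.trans hI)
  rw [Set.mem_ofPred_eq, permPValue, le_div_iff₀ hB] at hω
  refine hω.trans ?_
  gcongr with b
  split_ifs with h
  · rw [Set.indicator_of_mem (hTF b ω h)]
  · exact Set.indicator_nonneg (fun _ _ => zero_le_one) ω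

/-- The probability of an event that depends on a uniformly random permutation and on independent
data is the average over the permutations. -/
lemma measure_iUnion_perm_inter_le [IsProbabilityMeasure P] {N B : ℕ} {𝓧 : Type*}
    [MeasurableSpace 𝓧] {X : Ω → 𝓧} {π : Fin B → Ω → Equiv.Perm (Fin N)}
    (hπunif : ∀ b, P.map (π b) = uniformOn Set.univ) (hπ : ∀ b, Measurable (π b))
    (hXπ : IndepFun X (fun ω b => π b ω) P) {S : Equiv.Perm (Fin N) → Set 𝓧}
    (hS : ∀ ρ, MeasurableSet (S ρ)) {q : ENNReal}
    (hq : ∑ ρ, P (X ⁻¹' S ρ) ≤ Fintype.card (Equiv.Perm (Fin N)) * q) (b : Fin B) :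
    P (⋃ ρ, X ⁻¹' S ρ ∩ π b ⁻¹' {ρ}) ≤ q := by
  have hi : IndepFun X (π b) P :=
    hXπ.comp (φ := id) (ψ := fun f : Fin B → Equiv.Perm (Fin N) => f b) measurable_id
      (measurable_pi_apply b)
  have hc : (Fintype.card (Equiv.Perm (Fin N)) : ENNReal) ≠ 0 := by
    exact_mod_cast Fintype.card_ne_zero
  have hρ : ∀ ρ, P (π b ⁻¹' {ρ}) = (Fintype.card (Equiv.Perm (Fin N)) : ENNReal)⁻¹ := by
    intro ρ
    have hm : MeasurableSet ({ρ} : Set (Equiv.Perm (Fin N))) := trivial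
    have : MeasurableSingletonClass (Equiv.Perm (Fin N)) := ⟨fun _ => trivial⟩
    rw [← Measure.map_apply (hπ b) hm, hπunif, uniformOn_univ, Measure.count_singleton, one_div]
  calc P (⋃ ρ, X ⁻¹' S ρ ∩ π b ⁻¹' {ρ}) ≤ ∑ ρ, P (X ⁻¹' S ρ ∩ π b ⁻¹' {ρ}) :=
        measure_iUnion_fintype_le _ _
    _ = (∑ ρ, P (X ⁻¹' S ρ)) * (Fintype.card (Equiv.Perm (Fin N)) : ENNReal)⁻¹ := by
        rw [Finset.sum_mul]
        refine Finset.sum_congr rfl fun ρ _ => ?_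
        rw [hi.measure_inter_preimage_eq_mul _ _ (hS ρ) trivial, hρ]
    _ ≤ Fintype.card (Equiv.Perm (Fin N)) * q
          * (Fintype.card (Equiv.Perm (Fin N)) : ENNReal)⁻¹ := by gcongr
    _ = q := by
        rw [mul_right_comm, ENNReal.mul_inv_cancel hc (by simp), one_mul]

end PValue

/-! ### Assembly of the main theorem -/

theorem theorem3 :
    ∃ C : ℝ, 0 < C ∧
      ∀ (Ω : Type*) [MeasurableSpace Ω] (P : Measure Ω) [IsProbabilityMeasure P]
        (d n₁ n₂ B : ℕ) (_hd : 1 ≤ d) (_hn : n₁ ≤ n₂)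
        (α β : ℝ) (_hα : α ∈ Set.Ioo (0 : ℝ) 1) (_hβ : β ∈ Set.Ioo (0 : ℝ) 1)
        (_hαβ : α + β < 1 / 2)
        (σ : ℝ≥0) (_hσ : 0 < σ)
        -- the two samples
        (Z : Fin n₁ → Ω → EuclideanSpace ℝ (Fin d))
        (W : Fin n₂ → Ω → EuclideanSpace ℝ (Fin d))
        (_hZmeas : ∀ i, Measurable (Z i)) (_hWmeas : ∀ k, Measurable (W k))
        (_hindep : iIndepFun (Fin.append Z W) P)
        (_hZ : ∀ i, IsSubGaussianVector (Z i) (σ ^ 2) P)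
        (_hW : ∀ k, IsSubGaussianVector (W k) (σ ^ 2) P)
        (_hZmean : ∀ i j, ∫ ω, Z i ω ∂P = ∫ ω, Z j ω ∂P)
        (_hWmean : ∀ k l, ∫ ω, W k ω ∂P = ∫ ω, W l ω ∂P)
        -- `B` independent uniformly distributed permutations, independent of the samples
        (π : Fin B → Ω → Equiv.Perm (Fin (n₁ + n₂)))
        (_hπmeas : ∀ b, Measurable (π b))
        (_hπindep : iIndepFun π P)
        (_hπunif : ∀ b, P.map (π b) = uniformOn Set.univ)
        (_hπdata : IndepFun (fun ω (m : Fin (n₁ + n₂)) => Fin.append Z W m ω)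
          (fun ω b => π b ω) P)
        (_hB : 4 / (α * β) - 1 ≤ (B : ℝ))
        -- the separation criteria
        (_hsep : C * Real.sqrt d * (σ : ℝ) ^ 2 / n₁ * Real.log (1 / (α * β)) ^ 2
          ≤ ∫ ω, uStat (fun i => Z i ω) (fun k => W k ω) ∂P)
        (_hn₁ : C * Real.log (1 / (α * β)) ≤ (n₁ : ℝ)),
        P.real {ω | α ≤ uStatPValue (fun i => Z i ω) (fun k => W k ω) (fun b => π b ω)} ≤ β := by
  refine ⟨10000, by norm_num, ?_⟩
  intro Ω _ P _ d n₁ n₂ B hd hn α β hα hβ hαβ σ hσ Z W hZm hWm hindep hZ hW hZmean hWmean π hπm _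
    hπunif hπdata hB hsep hnL
  obtain ⟨hα0, -⟩ := hα
  obtain ⟨hβ0, -⟩ := hβ
  have hx0 : 0 < α * β := by positivity
  have hx16 : α * β ≤ 1 / 16 := by nlinarith [sq_nonneg (α - β)]
  set L := Real.log (1 / (α * β)) with hLdef
  have he := Real.exp_one_lt_d9
  have hexpL : Real.exp (-L) = α * β := by
    rw [hLdef, one_div, Real.log_inv, neg_neg, Real.exp_log hx0]
  -- From `αβ ≤ 1/16` and `e² < 16`.
  have hL : 2 ≤ L := by
    rw [hLdef, Real.le_log_iff_exp_le (by positivity), le_div_iff₀ hx0,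
      show (2 : ℝ) = 1 + 1 by norm_num, Real.exp_add]
    nlinarith [Real.exp_pos 1]
  have htail : Real.exp (1 - 2 * L) ≤ 3 / 8 * (α * β) := by
    rw [show 1 - 2 * L = 1 + (-L + -L) by ring, Real.exp_add, Real.exp_add, hexpL]
    have h : Real.exp 1 * (α * β) ≤ 3 / 8 := by nlinarith [Real.exp_pos 1]
    nlinarith
  have hn1 : 2 ≤ n₁ := by
    have : (2 : ℝ) ≤ n₁ := by linarith
    exact_mod_cast this
  set D := Fin.append Z W with hDdef
  have hDZ : ∀ i, D (Fin.castAdd n₂ i) = Z i := fun i => Fin.append_left _ _ _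
  have hDW : ∀ k, D (Fin.natAdd n₁ k) = W k := fun k => Fin.append_right _ _ _
  set a := ∫ ω, Z ⟨0, by omega⟩ ω ∂P with ha
  set b := ∫ ω, W ⟨0, by omega⟩ ω ∂P with hb
  have hDm : ∀ m, Measurable (D m) := fun m => by
    refine Fin.addCases (fun i => ?_) (fun k => ?_) m
    · rw [hDZ]; exact hZm i
    · rw [hDW]; exact hWm k
  have hDint : ∀ m, Integrable (D m) P := fun m => by
    refine Fin.addCases (fun i => ?_) (fun k => ?_) m
    · rw [hDZ]; exact (hZ i).integrable
    · rw [hDW]; exact (hW k).integrable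
  have hDsg : ∀ m, ExpMomentSubGaussian P
      (fun ω => D m ω - Fin.append (fun _ : Fin n₁ => a) (fun _ : Fin n₂ => b) m)
      ((σ : ℝ) ^ 2) := fun m => by
    refine Fin.addCases (fun i => ?_) (fun k => ?_) m
    · rw [hDZ, Fin.append_left, ha, hZmean _ i]
      simpa using (hZ i).expMomentSubGaussian
    · rw [hDW, Fin.append_right, hb, hWmean _ k]
      simpa using (hW k).expMomentSubGaussian
  have hmean : ∫ ω, uStat (fun i => Z i ω) (fun k => W k ω) ∂P = ‖a - b‖ ^ 2 := by
    have := integral_uStat hn1 (hn1.trans hn) hDm hindep hDint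
      (fun i => by rw [hDZ]; exact hZmean _ _) (fun k => by rw [hDW]; exact hWmean _ _)
      (a := a) (b := b)
    simpa only [hDZ, hDW] using this
  rw [hmean] at hsep
  obtain ⟨hlow, hup⟩ := measure_uStat_le_and_sum_measure_permutedUStat_ge hd hn hDm hindep
    (by positivity) hDsg hL hsep hnL
  simp only [hDZ, hDW] at hlow
  set Δ := ‖a - b‖ ^ 2
  let S : Equiv.Perm (Fin (n₁ + n₂)) → Set (Fin (n₁ + n₂) → EuclideanSpace ℝ (Fin d)) :=
    fun ρ => {x | Δ / 2 ≤ permutedUStat x ρ}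
  have hS : ∀ ρ, MeasurableSet (S ρ) := fun ρ =>
    measurableSet_le measurable_const (measurable_permutedUStat (fun m => measurable_pi_apply m) ρ)
  -- The bad event: the statistic is at most `Δ/2`, or its permuted version is at least `Δ/2`,
  -- decomposed by the value of the permutation.
  let F : Fin B → Set Ω := fun c => {ω | uStat (fun i => Z i ω) (fun k => W k ω) ≤ Δ / 2} ∪
    ⋃ ρ, (fun ω m => D m ω) ⁻¹' S ρ ∩ π c ⁻¹' {ρ}
  have hF : ∀ c, MeasurableSet (F c) := fun c =>
    (measurableSet_le (measurable_uStat hZm hWm) measurable_const).union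
      (MeasurableSet.iUnion fun ρ => (measurable_pi_lambda _ hDm (hS ρ)).inter (hπm c trivial))
  have hFq : ∀ c, P.real (F c) ≤ 3 / 4 * (α * β) := by
    intro c
    have h := (measure_union_le _ _).trans
      (add_le_add hlow (measure_iUnion_perm_inter_le hπunif hπm hπdata hS hup c))
    rw [← ENNReal.ofReal_add (Real.exp_pos _).le (Real.exp_pos _).le] at h
    have h' := ENNReal.toReal_mono ENNReal.ofReal_ne_top h
    rw [ENNReal.toReal_ofReal (by positivity)] at h'
    exact h'.trans (by linarith)
  have hTF : ∀ c ω, uStat (fun i => Z i ω) (fun k => W k ω)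
      ≤ permutedUStat (Fin.append (fun i => Z i ω) (fun k => W k ω)) (π c ω) → ω ∈ F c := by
    intro c ω h
    rcases le_or_gt (uStat (fun i => Z i ω) (fun k => W k ω)) (Δ / 2) with h' | h'
    · exact Or.inl h'
    · right
      rw [append_apply_eq] at h
      exact Set.mem_iUnion.2 ⟨π c ω, h'.le.trans h, rfl⟩
  refine (measureReal_permPValue_ge_le hF hTF hFq hα0).trans ?_
  rw [div_le_iff₀ (by positivity)]
  -- The leading `1` of the `p`-value takes a quarter of the budget `αβ(1 + B)`; the bad events take
  -- the other three quarters.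
  have hB' : 4 ≤ (1 + B) * (α * β) := by
    rw [← div_le_iff₀ hx0]
    linarith
  nlinarith
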